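/- Let $n\ge 1$, $\vec p=(p_1,\dots,p_n)$ with $1<p_i<\infty$ for every $i$, $0<q\le\infty$, $1<v<\infty$ and $0\le\lambda<\sum_{i=1}^n\frac1{p_i}$. For $r>0$ let $Q(0,r)=\{y\in\mathbb R^n:\ |y_i|<r \text{ for all } i\}$, and for a measurable set $E\subset\mathbb R^n$ let $$\|f\|_{L_{\vec p}(E)}=\left(\int_{\mathbb R}\cdots\left(\int_{\mathbb R}\left(\int_{\mathbb R}|f\chi_E(x)|^{p_1}\,dx_1\right)^{\frac{p_2}{p_1}}dx_2\right)^{\frac{p_3}{p_2}}\cdots dx_n\right)^{\frac1{p_n}}$$ be the mixed Lebesgue norm. The local mixed Morrey (quasi-)norm is $$\|f\|_{LM^{\lambda}_{\vec p,q}}=\left(\int_0^\infty\left(r^{-\lambda}\|f\|_{L_{\vec p}(Q(0,r))}\right)^q\frac{dr}{r}\right)^{\frac1q}\quad(q<\infty),\qquad \|f\|_{LM^{\lambda}_{\vec p,\infty}}=\operatorname*{ess\,sup}_{r>0}\, r^{-\lambda}\|f\|_{L_{\vec p}(Q(0,r))}.$$ Let $Mf(x)=\sup_{Q\ni x}\frac1{|Q|}\int_Q|f(y)|\,dy$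 be the Hardy–Littlewood maximal function, the supremum being over all cubes $Q\subset\mathbb R^n$ with sides parallel to the axes that contain $x$. Then there is a constant $C<\infty$, depending only on $n,\vec p,q,v,\lambda$, such that for every sequence $(f_j)_{j\ge1}$ of measurable functions $f_j:\mathbb R^n\to\mathbb C$, $$\left\|\left(\sum_{j=1}^\infty (Mf_j)^v\right)^{\frac1v}\right\|_{LM^{\lambda}_{\vec p,q}}\le C\left\|\left(\sum_{j=1}^\infty |f_j|^v\right)^{\frac1v}\right\|_{LM^{\lambda}_{\vec p,q}},$$ where both sides take values in $[0,\infty]$. -/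

import Mathlib

open MeasureTheory Set
open scoped ENNReal NNReal

noncomputable section

namespace LocalMixedMorrey

/-- The open cube `Q(c, r) = {y ∈ ℝⁿ : |y_i - c_i| < r for all i}` with sides parallel to the
coordinate axes, centre `c` and side length `2 r`. -/
def cube {n : ℕ} (c : Fin n → ℝ) (r : ℝ) : Set (Fin n → ℝ) :=
  {y | ∀ i, |y i - c i| < r}

/-- The mixed Lebesgue (quasi-)norm of a function `f : ℝⁿ → [0, ∞]` with exponents
`p = (p₁, …, pₙ)`:
`‖ … ‖ ‖f‖_{L^{p₁}(dx₁)} ‖_{L^{p₂}(dx₂)} … ‖_{L^{pₙ}(dxₙ)}`.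
The `L^{p₁}` norm in the first variable is taken first (innermost), the `L^{pₙ}` norm in the last
variable is taken last. -/
def mixedNorm : {n : ℕ} → (Fin n → ℝ≥0∞) → ((Fin n → ℝ) → ℝ≥0∞) → ℝ≥0∞
  | 0, _, f => f Fin.elim0
  | _ + 1, p, f =>
      mixedNorm (Fin.tail p) fun y => eLpNorm (fun t : ℝ => f (Fin.cons t y)) (p 0) volume

/-- `‖f‖_{L_p(E)}`, the mixed Lebesgue norm of `f` over a subset `E` of `ℝⁿ`. -/
def mixedNormOn {n : ℕ} (p : Fin n → ℝ≥0∞) (E : Set (Fin n → ℝ)) (f : (Fin n → ℝ) → ℝ≥0∞) :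
    ℝ≥0∞ :=
  mixedNorm p (E.indicator f)

/-- The measure `dr / r` on the half-line `(0, ∞)`. -/
def haarHalfLine : Measure ℝ :=
  (volume.restrict (Ioi (0 : ℝ))).withDensity fun r => ENNReal.ofReal r⁻¹

/-- The local mixed Morrey (quasi-)norm of a function `f : ℝⁿ → [0, ∞]`:
`(∫₀^∞ (r^{-lam} ‖f‖_{L_p(Q(0, r))})^q dr / r)^{1 / q}` for `q < ∞`, and the essential supremum of
`r^{-lam} ‖f‖_{L_p(Q(0, r))}` over `r > 0` for `q = ∞`. -/
def localMorreyNorm {n : ℕ} (p : Fin n → ℝ≥0∞) (q : ℝ≥0∞) (lam : ℝ)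
    (f : (Fin n → ℝ) → ℝ≥0∞) : ℝ≥0∞ :=
  eLpNorm (fun r : ℝ => ENNReal.ofReal (r ^ (-lam)) * mixedNormOn p (cube 0 r) f) q haarHalfLine

/-- The Hardy–Littlewood maximal function `M f (x) = sup_{Q ∋ x} |Q|⁻¹ ∫_Q |f|`, the supremum being
over all cubes `Q` that contain `x` and have sides parallel to the coordinate axes. -/
def maximal {n : ℕ} (f : (Fin n → ℝ) → ℂ) (x : Fin n → ℝ) : ℝ≥0∞ :=
  ⨆ (c : Fin n → ℝ) (r : ℝ) (_ : 0 < r) (_ : x ∈ cube c r),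
    (volume (cube c r))⁻¹ * ∫⁻ y in cube c r, ‖f y‖ₑ

/-- The `ℓ^v` norm `(∑_j a_j^v)^{1 / v}` of a sequence in `[0, ∞]`. -/
def seqNorm (v : ℝ) (a : ℕ → ℝ≥0∞) : ℝ≥0∞ :=
  (∑' j, a j ^ v) ^ (1 / v)

end LocalMixedMorrey

end

namespace LocalMixedMorrey

/-! ### The maximal function on the line for an arbitrary measure -/

/-- The uncentred maximal function of `f` on the line with respect to a measure `μ`, the supremum
being over open intervals with rational endpoints. -/
noncomputable def intervalMaximal (μ : Measure ℝ) (f : ℝ → ℝ≥0∞) (x : ℝ) : ℝ≥0∞ :=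
  ⨆ (I : ℚ × ℚ) (_ : x ∈ Ioo (I.1 : ℝ) I.2),
    (μ (Ioo (I.1 : ℝ) I.2))⁻¹ * ∫⁻ t in Ioo (I.1 : ℝ) I.2, f t ∂μ

theorem le_intervalMaximal (μ : Measure ℝ) (f : ℝ → ℝ≥0∞) {x : ℝ} (I : ℚ × ℚ)
    (hx : x ∈ Ioo (I.1 : ℝ) I.2) :
    (μ (Ioo (I.1 : ℝ) I.2))⁻¹ * ∫⁻ t in Ioo (I.1 : ℝ) I.2, f t ∂μ ≤ intervalMaximal μ f x :=
  le_iSup₂ (f := fun (I : ℚ × ℚ) (_ : x ∈ Ioo (I.1 : ℝ) I.2) =>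
    (μ (Ioo (I.1 : ℝ) I.2))⁻¹ * ∫⁻ t in Ioo (I.1 : ℝ) I.2, f t ∂μ) I hx

theorem measurable_intervalMaximal (μ : Measure ℝ) (f : ℝ → ℝ≥0∞) :
    Measurable (intervalMaximal μ f) := by
  have : intervalMaximal μ f = fun x => ⨆ I : ℚ × ℚ, (Ioo (I.1 : ℝ) I.2).indicator
      (fun _ => (μ (Ioo (I.1 : ℝ) I.2))⁻¹ * ∫⁻ t in Ioo (I.1 : ℝ) I.2, f t ∂μ) x := by
    funext x
    unfold intervalMaximal
    congr! 2 with I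
    by_cases hx : x ∈ Ioo (I.1 : ℝ) I.2
    · simp only [hx, iSup_pos, indicator_of_mem]
    · simp only [hx, iSup_neg, indicator_of_notMem, not_false_eq_true, bot_eq_zero]
  rw [this]
  exact Measurable.iSup fun I => measurable_const.indicator measurableSet_Ioo

/-- From a finite family of intervals one can select a subfamily with the same union in which no
point is covered more than twice. -/
theorem exists_subset_overlap_le_two (s : Finset (ℚ × ℚ)) :
    ∃ t ⊆ s, (⋃ I ∈ t, Ioo (I.1 : ℝ) I.2) = (⋃ I ∈ s, Ioo (I.1 : ℝ) I.2) ∧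
      ∀ x : ℝ, (t.filter fun I => x ∈ Ioo (I.1 : ℝ) I.2).card ≤ 2 := by
  induction s using Finset.strongInduction with
  | H s ih =>
    by_cases hred : ∃ c ∈ s, Ioo (c.1 : ℝ) c.2 ⊆ ⋃ I ∈ s.erase c, Ioo (I.1 : ℝ) I.2
    · obtain ⟨c, hc, hsub⟩ := hred
      obtain ⟨t, hts, hU, ht⟩ := ih _ (Finset.erase_ssubset hc)
      refine ⟨t, hts.trans (Finset.erase_subset _ _), ?_, ht⟩
      rw [hU]
      apply Subset.antisymm
      · exact biUnion_subset_biUnion_left fun I hI => Finset.mem_of_mem_erase hI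
      · refine iUnion₂_subset fun I hI => ?_
        by_cases hIc : I = c
        · exact hIc ▸ hsub
        · exact subset_biUnion_of_mem (u := fun I : ℚ × ℚ => Ioo (I.1 : ℝ) I.2)
            (Finset.mem_coe.2 (Finset.mem_erase.2 ⟨hIc, hI⟩))
    · refine ⟨s, subset_rfl, rfl, fun x => ?_⟩
      by_contra! hcard
      set A := s.filter fun I => x ∈ Ioo (I.1 : ℝ) I.2 with hA
      have hne : A.Nonempty := Finset.card_pos.1 (by omega)
      -- Of the intervals through `x`, the one reaching farthest left and the one reaching farthest
      -- right cover any third, which would then be redundant.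
      obtain ⟨a, haA, ha⟩ := A.exists_min_image (fun I => I.1) hne
      obtain ⟨b, hbA, hb⟩ := A.exists_max_image (fun I => I.2) hne
      obtain ⟨c, hcA, hc⟩ : ∃ c ∈ A, c ∉ ({a, b} : Finset (ℚ × ℚ)) := by
        by_contra! h
        have := Finset.card_le_card (show A ⊆ {a, b} from h)
        have := Finset.card_le_two (a := a) (b := b)
        omega
      simp only [Finset.mem_insert, Finset.mem_singleton, not_or] at hc
      refine hred ⟨c, (Finset.mem_filter.1 hcA).1, fun y hy => ?_⟩
      have hax := (Finset.mem_filter.1 haA).2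
      have hbx := (Finset.mem_filter.1 hbA).2
      have h1 : (a.1 : ℝ) ≤ c.1 := by exact_mod_cast ha c hcA
      have h2 : (c.2 : ℝ) ≤ b.2 := by exact_mod_cast hb c hcA
      simp only [mem_iUnion, Finset.mem_erase, exists_prop]
      by_cases hyx : y ≤ x
      · exact ⟨a, ⟨Ne.symm hc.1, (Finset.mem_filter.1 haA).1⟩, lt_of_le_of_lt h1 hy.1,
          lt_of_le_of_lt hyx hax.2⟩
      · exact ⟨b, ⟨Ne.symm hc.2, (Finset.mem_filter.1 hbA).1⟩, lt_trans hbx.1 (not_le.1 hyx),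
          lt_of_lt_of_le hy.2 h2⟩

/-- The factor 2 is the overlap of the selected subfamily; no doubling of `μ` is needed. -/
theorem mul_measure_biUnion_le {μ : Measure ℝ} {f : ℝ → ℝ≥0∞} (hf : Measurable f) (c : ℝ≥0∞)
    (s : Finset (ℚ × ℚ))
    (hs : ∀ I ∈ s, c * μ (Ioo (I.1 : ℝ) I.2) ≤ ∫⁻ t in Ioo (I.1 : ℝ) I.2, f t ∂μ) :
    c * μ (⋃ I ∈ s, Ioo (I.1 : ℝ) I.2) ≤ 2 * ∫⁻ t, f t ∂μ := by
  obtain ⟨t, hts, hU, ht⟩ := exists_subset_overlap_le_two s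
  rw [← hU]
  calc c * μ (⋃ I ∈ t, Ioo (I.1 : ℝ) I.2)
      ≤ c * ∑ I ∈ t, μ (Ioo (I.1 : ℝ) I.2) := by
        gcongr; exact measure_biUnion_finset_le _ _
    _ = ∑ I ∈ t, c * μ (Ioo (I.1 : ℝ) I.2) := Finset.mul_sum _ _ _
    _ ≤ ∑ I ∈ t, ∫⁻ x in Ioo (I.1 : ℝ) I.2, f x ∂μ :=
        Finset.sum_le_sum fun I hI => hs I (hts hI)
    _ = ∫⁻ x, ∑ I ∈ t, (Ioo (I.1 : ℝ) I.2).indicator f x ∂μ := by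
        rw [lintegral_finsetSum _ fun I _ => hf.indicator measurableSet_Ioo]
        exact Finset.sum_congr rfl fun I _ => (lintegral_indicator measurableSet_Ioo _).symm
    _ ≤ ∫⁻ x, 2 * f x ∂μ := by
        refine lintegral_mono fun x => ?_
        simp only [indicator_apply]
        rw [← Finset.sum_filter, Finset.sum_const, nsmul_eq_mul]
        gcongr
        exact_mod_cast ht x
    _ = 2 * ∫⁻ x, f x ∂μ := lintegral_const_mul _ hf

/-- The weak type `(1, 1)` inequality for the maximal function, with respect to any measure. -/
theorem mul_measure_lt_intervalMaximal_le {μ : Measure ℝ} {f : ℝ → ℝ≥0∞} (hf : Measurable f)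
    (c : ℝ≥0∞) : c * μ {x | c < intervalMaximal μ f x} ≤ 2 * ∫⁻ t, f t ∂μ := by
  let T : Set (ℚ × ℚ) := {I | c * μ (Ioo (I.1 : ℝ) I.2) ≤ ∫⁻ t in Ioo (I.1 : ℝ) I.2, f t ∂μ}
  let U : Finset T → Set ℝ := fun s => ⋃ I ∈ s.map (Function.Embedding.subtype _),
    Ioo (I.1 : ℝ) I.2
  have hsub : {x | c < intervalMaximal μ f x} ⊆ ⋃ s, U s := by
    intro x hx
    simp only [mem_ofPred_eq, intervalMaximal, lt_iSup_iff] at hx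
    obtain ⟨I, hxI, hI⟩ := hx
    have hT : I ∈ T := by
      have := hI.le
      rw [mul_comm, ← div_eq_mul_inv] at this
      exact ENNReal.mul_le_of_le_div this
    simp only [mem_iUnion]
    refine ⟨{⟨I, hT⟩}, ?_⟩
    exact mem_biUnion (Finset.mem_coe.2 (Finset.mem_map_of_mem (Function.Embedding.subtype _)
      (Finset.mem_singleton_self _))) hxI
  -- Finite unions form a countable directed family, so continuity from below reduces the estimate
  -- to finite families.
  have hdir : Directed (· ⊆ ·) U := by
    classical
    refine Monotone.directed_le fun s t hst => ?_
    exact biUnion_subset_biUnion_left (Finset.map_subset_map.2 hst)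
  calc c * μ {x | c < intervalMaximal μ f x} ≤ c * μ (⋃ s, U s) := by gcongr
    _ = ⨆ s, c * μ (U s) := by rw [hdir.measure_iUnion, ENNReal.mul_iSup]
    _ ≤ _ := iSup_le fun s => mul_measure_biUnion_le hf c _ fun I hI => by
        obtain ⟨J, -, rfl⟩ := Finset.mem_map.1 hI
        exact J.2

/-- Cutting `f` at height `c` changes its averages by at most `c`, so only the part of `f` above `c`
matters where the maximal function exceeds `2c`. This is the form that can be integrated over `c`.
-/
theorem mul_measure_two_mul_lt_intervalMaximal_le {μ : Measure ℝ} {f : ℝ → ℝ≥0∞}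
    (hf : Measurable f) (c : ℝ≥0∞) :
    c * μ {x | 2 * c < intervalMaximal μ f x} ≤ 2 * ∫⁻ t, {y | c < f y}.indicator f t ∂μ := by
  have hm : MeasurableSet {y | c < f y} := measurableSet_lt measurable_const hf
  refine le_trans ?_ (mul_measure_lt_intervalMaximal_le (hf.indicator hm) c)
  refine mul_le_mul_right (measure_mono fun x hx => ?_) _
  by_contra! hle
  refine absurd (show 2 * c < intervalMaximal μ f x from hx) (not_lt.2 ?_)
  refine iSup₂_le fun I hI => ?_
  have h0 := (le_intervalMaximal μ ({y | c < f y}.indicator f) I hI).trans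
    (show intervalMaximal μ ({y | c < f y}.indicator f) x ≤ c from not_lt.1 hle)
  calc (μ (Ioo (I.1 : ℝ) I.2))⁻¹ * ∫⁻ t in Ioo (I.1 : ℝ) I.2, f t ∂μ
      ≤ (μ (Ioo (I.1 : ℝ) I.2))⁻¹ * ∫⁻ t in Ioo (I.1 : ℝ) I.2,
          ({y | c < f y}.indicator f t + c) ∂μ := by
        gcongr with t
        by_cases ht : c < f t
        · simp [ht]
        · simpa [indicator_apply, ht] using not_lt.1 ht
    _ = (μ (Ioo (I.1 : ℝ) I.2))⁻¹ * ∫⁻ t in Ioo (I.1 : ℝ) I.2, {y | c < f y}.indicator f t ∂μ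
          + (μ (Ioo (I.1 : ℝ) I.2))⁻¹ * (c * μ (Ioo (I.1 : ℝ) I.2)) := by
        rw [lintegral_add_left (hf.indicator hm), mul_add]; simp
    _ ≤ c + c := by
        gcongr
        rw [mul_left_comm]
        exact mul_le_of_le_one_right' (ENNReal.inv_mul_le_one _)
    _ = 2 * c := (two_mul c).symm

theorem lintegral_ofReal_lt_rpow {p : ℝ} (hp : 0 < p) (a : ℝ≥0∞) :
    ∫⁻ t in Ioi (0 : ℝ), {s : ℝ | ENNReal.ofReal s < a}.indicator
      (fun s => ENNReal.ofReal (p * s ^ (p - 1))) t = a ^ p := by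
  have key : ∀ b : ℝ, 0 ≤ b → ∫⁻ t in Ioi (0 : ℝ), (Iio b).indicator
      (fun s => ENNReal.ofReal (p * s ^ (p - 1))) t = ENNReal.ofReal b ^ p := by
    intro b hb
    rw [lintegral_indicator measurableSet_Iio, Measure.restrict_restrict measurableSet_Iio,
      inter_comm, Ioi_inter_Iio, ← ofReal_integral_eq_lintegral_ofReal,
      ← integral_Ioc_eq_integral_Ioo, ← intervalIntegral.integral_of_le hb,
      intervalIntegral.integral_const_mul, integral_rpow (Or.inl (by linarith)),
      ENNReal.ofReal_rpow_of_nonneg hb hp.le]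
    · congr 1
      rw [sub_add_cancel, Real.zero_rpow hp.ne']
      field_simp
      simp
    · have h := (intervalIntegral.intervalIntegrable_rpow' (a := 0) (b := b)
        (r := p - 1) (by linarith)).const_mul p
      rw [intervalIntegrable_iff_integrableOn_Ioc_of_le hb] at h
      exact h.mono_set Ioo_subset_Ioc_self
    · refine (ae_restrict_mem measurableSet_Ioo).mono fun t ht => ?_
      have := ht.1
      positivity
  induction a using ENNReal.recTopCoe with
  | coe a =>
    have : {s : ℝ | ENNReal.ofReal s < a} ∩ Ioi 0 = Iio (a : ℝ) ∩ Ioi 0 := by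
      ext s
      simp only [mem_inter_iff, mem_ofPred_eq, mem_Ioi, mem_Iio]
      refine and_congr_left fun hs => ?_
      rw [← ENNReal.ofReal_coe_nnreal, ENNReal.ofReal_lt_ofReal_iff_of_nonneg hs.le]
    rw [← ENNReal.ofReal_coe_nnreal, ← key a a.2, ENNReal.ofReal_coe_nnreal]
    refine setLIntegral_congr_fun measurableSet_Ioi fun s hs => ?_
    have hs' : (ENNReal.ofReal s < a) ↔ s < a := by
      rw [← ENNReal.ofReal_coe_nnreal, ENNReal.ofReal_lt_ofReal_iff_of_nonneg (le_of_lt hs)]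
    simp [indicator_apply, hs']
  | top =>
    rw [ENNReal.top_rpow_of_pos hp, eq_top_iff]
    refine le_of_tendsto' (f := fun n : ℕ => ENNReal.ofReal n ^ p) (x := Filter.atTop) ?_ ?_
    · have h := (ENNReal.continuous_rpow_const (y := p)).tendsto ⊤
      rw [ENNReal.top_rpow_of_pos hp] at h
      exact h.comp (ENNReal.tendsto_ofReal_atTop.comp tendsto_natCast_atTop_atTop)
    · intro n
      rw [← key n n.cast_nonneg]
      refine lintegral_mono fun s => ?_
      refine indicator_le_indicator_of_subset (fun s _ => ?_) (fun _ => bot_le) s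
      simp

/-- The factor `g` lets the formula be used in both directions: with `g` constant to open the norm
of the maximal function, and with `g = f` and exponent `p - 1` to close it again. -/
theorem lintegral_rpow_eq_layercake {α : Type*} [MeasurableSpace α] (μ : Measure α) [SFinite μ]
    {f g : α → ℝ≥0∞} (hf : Measurable f) (hg : Measurable g) {p : ℝ} (hp : 0 < p) :
    ∫⁻ x, g x * f x ^ p ∂μ = ∫⁻ t in Ioi (0 : ℝ), ENNReal.ofReal (p * t ^ (p - 1)) *
      ∫⁻ x, {y | ENNReal.ofReal t < f y}.indicator g x ∂μ := by
  have hmeas : Measurable (fun z : α × ℝ => {w : α × ℝ | ENNReal.ofReal w.2 < f w.1}.indicator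
      (fun w => g w.1 * ENNReal.ofReal (p * w.2 ^ (p - 1))) z) := by
    apply Measurable.indicator
    · fun_prop
    · exact measurableSet_lt (by fun_prop) (by fun_prop)
  calc ∫⁻ x, g x * f x ^ p ∂μ = ∫⁻ x, (∫⁻ t in Ioi (0 : ℝ),
        {w : α × ℝ | ENNReal.ofReal w.2 < f w.1}.indicator
          (fun w => g w.1 * ENNReal.ofReal (p * w.2 ^ (p - 1))) (x, t)) ∂μ := by
        refine lintegral_congr fun x => ?_
        rw [← lintegral_ofReal_lt_rpow hp, ← lintegral_const_mul]
        · refine lintegral_congr fun t => ?_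
          by_cases h : ENNReal.ofReal t < f x <;> simp [h]
        · exact Measurable.indicator (by fun_prop)
            (measurableSet_lt (by fun_prop) measurable_const)
    _ = _ := by
        rw [lintegral_lintegral_swap hmeas.aemeasurable]
        refine lintegral_congr fun t => ?_
        rw [← lintegral_const_mul _ (hg.indicator (measurableSet_lt measurable_const hf))]
        refine lintegral_congr fun x => ?_
        by_cases h : ENNReal.ofReal t < f x <;> simp [h, mul_comm]

/-- The maximal function is bounded on `L^p(μ)` for every `p > 1` and every measure `μ`. -/
theorem exists_lintegral_intervalMaximal_rpow_le {p : ℝ} (hp : 1 < p) :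
    ∃ C : ℝ≥0, ∀ (μ : Measure ℝ) [SFinite μ] (f : ℝ → ℝ≥0∞), Measurable f →
      ∫⁻ x, intervalMaximal μ f x ^ p ∂μ ≤ C * ∫⁻ x, f x ^ p ∂μ := by
  have hp0 : 0 < p := by linarith
  have hp1 : 0 < p - 1 := by linarith
  -- `2 ^ p` comes from halving the maximal function, `2` from the weak type bound, and `p / (p -
  -- 1)` from the ratio of the two layer-cake densities.
  refine ⟨(2 ^ p * 2 * p / (p - 1)).toNNReal, fun μ _ f hf => ?_⟩
  have hM := measurable_intervalMaximal μ f
  calc ∫⁻ x, intervalMaximal μ f x ^ p ∂μ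
      = ∫⁻ x, (fun _ => (2 : ℝ≥0∞) ^ p) x * (2⁻¹ * intervalMaximal μ f x) ^ p ∂μ := by
        refine lintegral_congr fun x => ?_
        rw [← ENNReal.mul_rpow_of_nonneg _ _ hp0.le, ← mul_assoc,
          ENNReal.mul_inv_cancel two_ne_zero ENNReal.ofNat_ne_top, one_mul]
    _ = ∫⁻ t in Ioi (0 : ℝ), ENNReal.ofReal (p * t ^ (p - 1)) * (2 ^ p *
          μ {y | 2 * ENNReal.ofReal t < intervalMaximal μ f y}) := by
        rw [lintegral_rpow_eq_layercake μ (by fun_prop) measurable_const hp0]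
        refine lintegral_congr fun t => ?_
        rw [lintegral_indicator (measurableSet_lt measurable_const (by fun_prop)),
          setLIntegral_const]
        congr! 5 with y
        rw [mul_comm 2⁻¹, ← div_eq_mul_inv, ENNReal.lt_div_iff_mul_lt (by simp) (by simp),
          mul_comm]
    _ ≤ ∫⁻ t in Ioi (0 : ℝ), ENNReal.ofReal (2 ^ p * 2 * p / (p - 1)) *
          (ENNReal.ofReal ((p - 1) * t ^ (p - 1 - 1)) *
          ∫⁻ x, {y | ENNReal.ofReal t < f y}.indicator f x ∂μ) := by
        refine setLIntegral_mono' measurableSet_Ioi fun t ht => ?_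
        have ht : 0 < t := ht
        have h := mul_measure_two_mul_lt_intervalMaximal_le (μ := μ) hf (ENNReal.ofReal t)
        have e1 : ENNReal.ofReal (p * t ^ (p - 1)) =
            ENNReal.ofReal (p * t ^ (p - 1 - 1)) * ENNReal.ofReal t := by
          rw [← ENNReal.ofReal_mul (by positivity), Real.rpow_sub_one ht.ne' (p - 1)]
          congr 1
          field_simp
        have e2 : ENNReal.ofReal (2 ^ p * 2 * p / (p - 1)) *
            ENNReal.ofReal ((p - 1) * t ^ (p - 1 - 1)) =
            ENNReal.ofReal (p * t ^ (p - 1 - 1)) * (2 ^ p * 2) := by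
          have : (2 : ℝ≥0∞) ^ p * 2 = ENNReal.ofReal (2 ^ p * 2) := by
            rw [ENNReal.ofReal_mul (by positivity), ← ENNReal.ofReal_rpow_of_pos two_pos]
            simp
          rw [this, ← ENNReal.ofReal_mul (by positivity), ← ENNReal.ofReal_mul (by positivity)]
          congr 1
          field_simp
        rw [← mul_assoc (ENNReal.ofReal (2 ^ p * 2 * p / (p - 1))), e1, e2]
        calc _ = ENNReal.ofReal (p * t ^ (p - 1 - 1)) * (2 ^ p * (ENNReal.ofReal t *
              μ {y | 2 * ENNReal.ofReal t < intervalMaximal μ f y})) := by ring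
          _ ≤ ENNReal.ofReal (p * t ^ (p - 1 - 1)) * (2 ^ p *
              (2 * ∫⁻ x, {y | ENNReal.ofReal t < f y}.indicator f x ∂μ)) := by gcongr
          _ = _ := by ring
    _ = ENNReal.ofReal (2 ^ p * 2 * p / (p - 1)) * ∫⁻ x, f x * f x ^ (p - 1) ∂μ := by
        rw [lintegral_const_mul' _ _ ENNReal.ofReal_ne_top,
          lintegral_rpow_eq_layercake μ hf hf hp1]
    _ = _ := by
        congr 2
        funext x
        by_cases h0 : f x = 0
        · simp [h0, hp0]
        by_cases ht : f x = ⊤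
        · simp [ht, hp0, hp1]
        conv_lhs => rw [← ENNReal.rpow_one (f x), ENNReal.rpow_one]
        nth_rewrite 1 [← ENNReal.rpow_one (f x)]
        rw [← ENNReal.rpow_add _ _ h0 ht]
        congr 1
        ring

/-! ### `A₁` weights and factored `A_p` weights -/

/-- `u` is a Muckenhoupt `A₁` weight on the line, with constant `K`. -/
structure IsA1 (K : ℝ≥0) (u : ℝ → ℝ≥0∞) : Prop where
  measurable : Measurable u
  maximal_le : ∀ x, intervalMaximal volume u x ≤ K * u x
  ne_zero : ∀ᵐ x, u x ≠ 0
  ne_top : ∀ᵐ x, u x ≠ ⊤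

theorem IsA1.mono {K K' : ℝ≥0} (h : K ≤ K') {u : ℝ → ℝ≥0∞} (hu : IsA1 K u) : IsA1 K' u :=
  ⟨hu.measurable, fun x => (hu.maximal_le x).trans (by gcongr), hu.ne_zero, hu.ne_top⟩

theorem isA1_one : IsA1 1 (fun _ => 1) := by
  refine ⟨measurable_const, fun x => ?_, by simp, by simp⟩
  refine iSup₂_le fun I _ => ?_
  simp [ENNReal.inv_mul_le_one]

/-- The weight `u^{1 - p} v`; by Jones' factorisation theorem all `A_p` weights are of this form
with `u` and `v` in `A₁`. -/
noncomputable def apWeight (p : ℝ) (u v : ℝ → ℝ≥0∞) (x : ℝ) : ℝ≥0∞ := u x ^ (1 - p) * v x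

theorem measurable_apWeight (p : ℝ) {u v : ℝ → ℝ≥0∞} (hu : Measurable u) (hv : Measurable v) :
    Measurable (apWeight p u v) := by
  unfold apWeight; fun_prop

section Interval

variable {I : ℚ × ℚ}

theorem volume_Ioo_ne_zero (hI : I.1 < I.2) : volume (Ioo (I.1 : ℝ) I.2) ≠ 0 := by
  rw [Real.volume_Ioo]
  have : (I.1 : ℝ) < I.2 := by exact_mod_cast hI
  simpa using this

theorem volume_Ioo_ne_top : volume (Ioo (I.1 : ℝ) I.2) ≠ ⊤ := by
  rw [Real.volume_Ioo]; exact ENNReal.ofReal_ne_top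

theorem IsA1.setLIntegral_le {K : ℝ≥0} {u : ℝ → ℝ≥0∞} (hu : IsA1 K u) (hI : I.1 < I.2) {x : ℝ}
    (hx : x ∈ Ioo (I.1 : ℝ) I.2) :
    ∫⁻ t in Ioo (I.1 : ℝ) I.2, u t ≤ volume (Ioo (I.1 : ℝ) I.2) * (K * u x) := by
  have := (le_intervalMaximal volume u I hx).trans (hu.maximal_le x)
  rwa [mul_comm, ← div_eq_mul_inv, ENNReal.div_le_iff (volume_Ioo_ne_zero hI) volume_Ioo_ne_top,
    mul_comm] at this

theorem IsA1.setLIntegral_ne_zero {K : ℝ≥0} {u : ℝ → ℝ≥0∞} (hu : IsA1 K u) (hI : I.1 < I.2) :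
    ∫⁻ t in Ioo (I.1 : ℝ) I.2, u t ≠ 0 := by
  rw [ne_eq, setLIntegral_eq_zero_iff measurableSet_Ioo hu.measurable]
  intro h
  apply volume_Ioo_ne_zero hI
  rw [measure_eq_zero_iff_ae_notMem]
  filter_upwards [h, hu.ne_zero] with x h1 h2 h3
  exact h2 (h1 h3)

/-- Local integrability need not be assumed: the weight is finite at some point of the interval, and
its value there bounds the average. -/
theorem IsA1.setLIntegral_ne_top {K : ℝ≥0} {u : ℝ → ℝ≥0∞} (hu : IsA1 K u) (hI : I.1 < I.2) :
    ∫⁻ t in Ioo (I.1 : ℝ) I.2, u t ≠ ⊤ := by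
  have : ∃ x ∈ Ioo (I.1 : ℝ) I.2, u x ≠ ⊤ := by
    by_contra! h
    apply volume_Ioo_ne_zero hI
    rw [measure_eq_zero_iff_ae_notMem]
    filter_upwards [hu.ne_top] with x h1 h2
    exact h1 (h x h2)
  obtain ⟨x, hx, hux⟩ := this
  exact ne_top_of_le_ne_top (ENNReal.mul_ne_top volume_Ioo_ne_top
    (ENNReal.mul_ne_top ENNReal.coe_ne_top hux)) (hu.setLIntegral_le hI hx)

/-- Reverse of `IsA1.setLIntegral_le` for a negative power of the weight. -/
theorem IsA1.setLIntegral_rpow_neg_mul_le {K L : ℝ≥0} {u v : ℝ → ℝ≥0∞} (hu : IsA1 K u)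
    (hv : IsA1 L v) (hI : I.1 < I.2) {a : ℝ} (ha : 0 ≤ a) :
    ∫⁻ t in Ioo (I.1 : ℝ) I.2, u t ^ (-a) * v t ≤
      ((volume (Ioo (I.1 : ℝ) I.2) * K)⁻¹ * ∫⁻ t in Ioo (I.1 : ℝ) I.2, u t) ^ (-a) *
        ∫⁻ t in Ioo (I.1 : ℝ) I.2, v t := by
  rw [← lintegral_const_mul _ hv.measurable]
  -- The `A₁` condition bounds `u` from below on the interval by its average over `K`, hence bounds
  -- its negative power from above pointwise.
  refine setLIntegral_mono' measurableSet_Ioo fun x hx => ?_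
  gcongr ?_ * _
  rw [ENNReal.rpow_neg, ENNReal.rpow_neg]
  gcongr
  have := hu.setLIntegral_le hI hx
  rw [← mul_assoc] at this
  rw [mul_comm, ← div_eq_mul_inv]
  exact ENNReal.div_le_of_le_mul' this

end Interval

theorem IsA1.apWeight_ne {K : ℝ≥0} {u v : ℝ → ℝ≥0∞} (p : ℝ) (hu : IsA1 K u) (hv : IsA1 K v) :
    ∀ᵐ x, apWeight p u v x ≠ 0 ∧ apWeight p u v x ≠ ⊤ := by
  filter_upwards [hu.ne_zero, hu.ne_top, hv.ne_zero, hv.ne_top] with x h1 h2 h3 h4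
  refine ⟨mul_ne_zero ?_ h3, ENNReal.mul_ne_top ?_ h4⟩
  · simp [ENNReal.rpow_eq_zero_iff, h1, h2]
  · exact ENNReal.rpow_ne_top_of_ne_zero h1 h2

/-- The `A_p` condition for the weights `u^{1 - p} v`. -/
theorem IsA1.apWeight_condition {K : ℝ≥0} {u v : ℝ → ℝ≥0∞} {p : ℝ} (hp : 1 < p) (hu : IsA1 K u)
    (hv : IsA1 K v) {I : ℚ × ℚ} (hI : I.1 < I.2) :
    (∫⁻ t in Ioo (I.1 : ℝ) I.2, apWeight p u v t) *
      (∫⁻ t in Ioo (I.1 : ℝ) I.2, apWeight p u v t ^ (-(p - 1)⁻¹)) ^ (p - 1) ≤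
      (volume (Ioo (I.1 : ℝ) I.2) * K) ^ p := by
  have hp1 : 0 < p - 1 := by linarith
  set a := ∫⁻ t in Ioo (I.1 : ℝ) I.2, u t with ha
  set b := ∫⁻ t in Ioo (I.1 : ℝ) I.2, v t with hb
  set ℓ := volume (Ioo (I.1 : ℝ) I.2) with hℓ
  have ha0 : a ≠ 0 := hu.setLIntegral_ne_zero hI
  have hb0 : b ≠ 0 := hv.setLIntegral_ne_zero hI
  have hat : a ≠ ⊤ := hu.setLIntegral_ne_top hI
  have hbt : b ≠ ⊤ := hv.setLIntegral_ne_top hI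
  have hK : (K : ℝ≥0∞) ≠ 0 := by
    intro hK
    obtain ⟨x, hx⟩ : (Ioo (I.1 : ℝ) I.2).Nonempty := nonempty_Ioo.2 (by exact_mod_cast hI)
    have := hu.setLIntegral_le hI hx
    rw [hK, zero_mul, mul_zero] at this
    exact ha0 (le_antisymm this bot_le)
  set k := ℓ * K with hk
  have hk0 : k ≠ 0 := mul_ne_zero (volume_Ioo_ne_zero hI) hK
  have hkt : k ≠ ⊤ := ENNReal.mul_ne_top volume_Ioo_ne_top ENNReal.coe_ne_top
  have hki0 : k⁻¹ ≠ 0 := ENNReal.inv_ne_zero.2 hkt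
  have hkit : k⁻¹ ≠ ⊤ := ENNReal.inv_ne_top.2 hk0
  have h1 : ∫⁻ t in Ioo (I.1 : ℝ) I.2, apWeight p u v t ≤ (k⁻¹ * a) ^ (-(p - 1)) * b := by
    have := hu.setLIntegral_rpow_neg_mul_le hv hI hp1.le
    simpa only [apWeight, neg_sub] using this
  -- The dual weight `u * v ^ (-(p - 1)⁻¹)` has the same shape with the roles of `u` and `v`
  -- exchanged.
  have h2 : ∫⁻ t in Ioo (I.1 : ℝ) I.2, apWeight p u v t ^ (-(p - 1)⁻¹) ≤
      (k⁻¹ * b) ^ (-(p - 1)⁻¹) * a := by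
    refine le_trans (le_of_eq ?_) (hv.setLIntegral_rpow_neg_mul_le hu hI (inv_pos.2 hp1).le)
    refine lintegral_congr_ae (ae_restrict_of_ae ?_)
    filter_upwards [hu.ne_zero, hu.ne_top, hv.ne_zero, hv.ne_top] with x h1 h2 h3 h4
    rw [apWeight, ENNReal.mul_rpow_of_ne_top (ENNReal.rpow_ne_top_of_ne_zero h1 h2) h4,
      ← ENNReal.rpow_mul, mul_comm]
    congr 1
    conv_rhs => rw [← ENNReal.rpow_one (u x)]
    congr 1
    field_simp
    ring
  calc _ ≤ ((k⁻¹ * a) ^ (-(p - 1)) * b) * ((k⁻¹ * b) ^ (-(p - 1)⁻¹) * a) ^ (p - 1) := by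
        gcongr
    _ = (k⁻¹ ^ (-(p - 1)) * k⁻¹ ^ (-1 : ℝ)) * (a ^ (-(p - 1)) * a ^ (p - 1)) *
          (b ^ (-1 : ℝ) * b) := by
        rw [ENNReal.mul_rpow_of_nonneg _ _ hp1.le, ← ENNReal.rpow_mul,
          ENNReal.mul_rpow_of_ne_top hkit hat, ENNReal.mul_rpow_of_ne_top hkit hbt,
          show -(p - 1)⁻¹ * (p - 1) = -1 by field_simp]
        ring
    _ = k ^ p := by
        rw [ENNReal.rpow_neg_one b, ENNReal.inv_mul_cancel hb0 hbt,
          ← ENNReal.rpow_add _ _ ha0 hat, ← ENNReal.rpow_add _ _ hki0 hkit, neg_add_cancel,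
          ENNReal.rpow_zero, mul_one, mul_one, ENNReal.inv_rpow, ← ENNReal.rpow_neg]
        congr 1
        ring
    _ = _ := rfl

/-! ### Muckenhoupt's theorem -/

/-- Pointwise control of the maximal function by weighted maximal functions. -/
theorem intervalMaximal_rpow_le {K : ℝ≥0} {p : ℝ} (hp : 1 < p) {w f : ℝ → ℝ≥0∞}
    (hw : Measurable w) (hf : Measurable f) (hw0 : ∀ᵐ x, w x ≠ 0 ∧ w x ≠ ⊤)
    (hK : ∀ I : ℚ × ℚ, I.1 < I.2 → (∫⁻ t in Ioo (I.1 : ℝ) I.2, w t) *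
      (∫⁻ t in Ioo (I.1 : ℝ) I.2, w t ^ (-(p - 1)⁻¹)) ^ (p - 1) ≤
      (volume (Ioo (I.1 : ℝ) I.2) * K) ^ p) (x : ℝ) :
    intervalMaximal volume f x ^ (p - 1) ≤ K ^ p * intervalMaximal (volume.withDensity w)
      (fun y => intervalMaximal (volume.withDensity fun t => w t ^ (-(p - 1)⁻¹))
        (fun t => f t * (w t ^ (-(p - 1)⁻¹))⁻¹) y ^ (p - 1) * (w y)⁻¹) x := by
  have hp1 : 0 < p - 1 := by linarith
  set σ : ℝ → ℝ≥0∞ := fun t => w t ^ (-(p - 1)⁻¹) with hσdef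
  have hσ : Measurable σ := by fun_prop
  have hσ0 : ∀ᵐ x, σ x ≠ 0 ∧ σ x ≠ ⊤ := by
    filter_upwards [hw0] with x h
    exact ⟨by simp [hσdef, ENNReal.rpow_eq_zero_iff, h.1, h.2],
      ENNReal.rpow_ne_top_of_ne_zero h.1 h.2⟩
  set φ := intervalMaximal (volume.withDensity σ) (fun t => f t * (σ t)⁻¹) with hφ
  have hφm : Measurable φ := measurable_intervalMaximal _ _
  set ψ := intervalMaximal (volume.withDensity w) (fun y => φ y ^ (p - 1) * (w y)⁻¹) with hψ
  rw [← ENNReal.le_rpow_inv_iff hp1]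
  refine iSup₂_le fun I hx => ?_
  rw [ENNReal.le_rpow_inv_iff hp1]
  have hI : I.1 < I.2 := by exact_mod_cast hx.1.trans hx.2
  have hK := hK I hI
  set J := Ioo (I.1 : ℝ) I.2 with hJ
  set ℓ := volume J with hℓ
  have hℓ0 : ℓ ≠ 0 := volume_Ioo_ne_zero hI
  have hℓt : ℓ ≠ ⊤ := volume_Ioo_ne_top
  have cancel : ∀ {g ρ : ℝ → ℝ≥0∞}, Measurable g → Measurable ρ →
      (∀ᵐ x, ρ x ≠ 0 ∧ ρ x ≠ ⊤) →
      ∫⁻ t in J, g t = ∫⁻ t in J, g t * (ρ t)⁻¹ ∂(volume.withDensity ρ) := by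
    intro g ρ hg hρ hρ0
    rw [restrict_withDensity measurableSet_Ioo,
      lintegral_withDensity_eq_lintegral_mul _ hρ (by fun_prop)]
    refine lintegral_congr_ae (ae_restrict_of_ae ?_)
    filter_upwards [hρ0] with t ht
    rw [Pi.mul_apply, mul_comm, mul_assoc, ENNReal.inv_mul_cancel ht.1 ht.2, mul_one]
  have pos : ∀ {ρ : ℝ → ℝ≥0∞}, Measurable ρ → (∀ᵐ x, ρ x ≠ 0 ∧ ρ x ≠ ⊤) →
      ∫⁻ t in J, ρ t ≠ 0 := by
    intro ρ hρ hρ0 h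
    rw [setLIntegral_eq_zero_iff measurableSet_Ioo hρ] at h
    apply hℓ0
    rw [hℓ, measure_eq_zero_iff_ae_notMem]
    filter_upwards [h, hρ0] with x h1 h2 h3
    exact h2.1 (h1 h3)
  have hkt : (ℓ * K) ^ p ≠ ⊤ := ENNReal.rpow_ne_top_of_nonneg (by linarith)
    (ENNReal.mul_ne_top hℓt ENNReal.coe_ne_top)
  have hw_pos := pos hw hw0
  have hσ_pos := pos hσ hσ0
  have hw_top : ∫⁻ t in J, w t ≠ ⊤ := by
    intro h
    rw [h, ENNReal.top_mul (by simp [ENNReal.rpow_eq_zero_iff, hσ_pos, hp.le])] at hK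
    exact hkt (top_le_iff.1 hK)
  have hσ_top : ∫⁻ t in J, σ t ≠ ⊤ := by
    intro h
    rw [h, ENNReal.top_rpow_of_pos hp1, ENNReal.mul_top hw_pos] at hK
    exact hkt (top_le_iff.1 hK)
  have avg : ∀ {g ρ : ℝ → ℝ≥0∞}, Measurable g → Measurable ρ →
      (∀ᵐ x, ρ x ≠ 0 ∧ ρ x ≠ ⊤) → ∫⁻ t in J, ρ t ≠ ⊤ → ∀ y ∈ J, ∫⁻ t in J, g t ≤
      (∫⁻ t in J, ρ t) * intervalMaximal (volume.withDensity ρ) (fun t => g t * (ρ t)⁻¹) y := by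
    intro g ρ hg hρ hρ0 hρt y hy
    have h := le_intervalMaximal (volume.withDensity ρ) (fun t => g t * (ρ t)⁻¹) I hy
    rw [← hJ, ← cancel hg hρ hρ0, withDensity_apply _ measurableSet_Ioo, mul_comm,
      ← div_eq_mul_inv, ENNReal.div_le_iff (pos hρ hρ0) hρt, mul_comm] at h
    exact h
  -- The `σ`-average of `f / σ` over `J` is at most `φ y` for every `y` in `J`. Integrating this
  -- over `y` produces an integral of `φ ^ (p - 1)`, which `h2` reads as a `w`-average.
  have h1 : (∫⁻ t in J, f t) ^ (p - 1) * ℓ ≤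
      (∫⁻ t in J, σ t) ^ (p - 1) * ∫⁻ t in J, φ t ^ (p - 1) := by
    rw [← lintegral_const_mul _ (by fun_prop), ← setLIntegral_const]
    refine setLIntegral_mono' measurableSet_Ioo fun y hy => ?_
    rw [← ENNReal.mul_rpow_of_nonneg _ _ hp1.le]
    gcongr
    exact avg hf hσ hσ0 hσ_top y hy
  have h2 : ∫⁻ t in J, φ t ^ (p - 1) ≤ (∫⁻ t in J, w t) * ψ x :=
    avg (by fun_prop) hw hw0 hw_top x hx
  calc (ℓ⁻¹ * ∫⁻ t in J, f t) ^ (p - 1)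
      = (ℓ⁻¹ ^ p) * ((∫⁻ t in J, f t) ^ (p - 1) * ℓ) := by
        rw [ENNReal.mul_rpow_of_nonneg _ _ hp1.le, ENNReal.rpow_sub _ _ (ENNReal.inv_ne_zero.2 hℓt)
          (ENNReal.inv_ne_top.2 hℓ0), ENNReal.rpow_one, div_eq_mul_inv, inv_inv]
        ring
    _ ≤ ℓ⁻¹ ^ p * ((∫⁻ t in J, σ t) ^ (p - 1) * ((∫⁻ t in J, w t) * ψ x)) := by
        exact mul_le_mul_right (h1.trans (mul_le_mul_right h2 _)) _
    _ = ℓ⁻¹ ^ p * ((∫⁻ t in J, w t) * (∫⁻ t in J, σ t) ^ (p - 1)) * ψ x := by ring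
    _ ≤ ℓ⁻¹ ^ p * (ℓ * K) ^ p * ψ x := by gcongr
    _ = K ^ p * ψ x := by
        rw [← ENNReal.mul_rpow_of_nonneg _ _ (by linarith), ← mul_assoc,
          ENNReal.inv_mul_cancel hℓ0 hℓt, one_mul]

/-- **Muckenhoupt's theorem** for the weights `u^{1 - p} v`. -/
theorem exists_lintegral_intervalMaximal_rpow_mul_apWeight_le {p : ℝ} (hp : 1 < p) (K : ℝ≥0) :
    ∃ C : ℝ≥0, ∀ u v f : ℝ → ℝ≥0∞, IsA1 K u → IsA1 K v → Measurable f →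
      ∫⁻ x, intervalMaximal volume f x ^ p * apWeight p u v x ≤
        C * ∫⁻ x, f x ^ p * apWeight p u v x := by
  have hp0 : 0 < p := by linarith
  have hp1 : 0 < p - 1 := by linarith
  have hq : 1 < p / (p - 1) := by rw [lt_div_iff₀ hp1]; linarith
  have hq0 : 0 < p / (p - 1) := by linarith
  -- The weighted maximal functions are bounded on `L^p(σ)` and on `L^{p/(p-1)}(w)`. The exponents
  -- match because `w ^ (1 - p/(p-1)) = σ` and `σ ^ (1 - p) = w`.
  obtain ⟨C₁, hC₁⟩ := exists_lintegral_intervalMaximal_rpow_le hp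
  obtain ⟨C₂, hC₂⟩ := exists_lintegral_intervalMaximal_rpow_le hq
  refine ⟨(K ^ p) ^ (p / (p - 1)) * (C₂ * C₁), fun u v f hu hv hf => ?_⟩
  set w := apWeight p u v with hwdef
  have hw : Measurable w := measurable_apWeight p hu.measurable hv.measurable
  have hw0 : ∀ᵐ x, w x ≠ 0 ∧ w x ≠ ⊤ := hu.apWeight_ne p hv
  set σ : ℝ → ℝ≥0∞ := fun t => w t ^ (-(p - 1)⁻¹) with hσdef
  have hσ : Measurable σ := by fun_prop
  set φ := intervalMaximal (volume.withDensity σ) (fun t => f t * (σ t)⁻¹) with hφ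
  have hφm : Measurable φ := measurable_intervalMaximal _ _
  have hMm := measurable_intervalMaximal volume f
  set ψ := intervalMaximal (volume.withDensity w) (fun y => φ y ^ (p - 1) * (w y)⁻¹) with hψ
  have hψm : Measurable ψ := measurable_intervalMaximal _ _
  have dens : ∀ {g ρ : ℝ → ℝ≥0∞}, Measurable g → Measurable ρ →
      ∫⁻ x, g x ∂(volume.withDensity ρ) = ∫⁻ x, g x * ρ x := by
    intro g ρ hg hρ
    rw [lintegral_withDensity_eq_lintegral_mul _ hρ hg]
    simp only [Pi.mul_apply, mul_comm]
  calc ∫⁻ x, intervalMaximal volume f x ^ p * w x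
      ≤ ∫⁻ x, ((K ^ p) ^ (p / (p - 1)) : ℝ≥0) * (ψ x ^ (p / (p - 1)) * w x) := by
        refine lintegral_mono fun x => ?_
        rw [← mul_assoc]
        gcongr
        have h := intervalMaximal_rpow_le hp hw hf hw0
          (fun I hI => hu.apWeight_condition hp hv hI) x
        have h := ENNReal.rpow_le_rpow h hq0.le
        rw [← ENNReal.rpow_mul, mul_div_cancel₀ _ hp1.ne',
          ENNReal.mul_rpow_of_nonneg _ _ hq0.le] at h
        rwa [ENNReal.coe_rpow_of_nonneg _ hq0.le, ENNReal.coe_rpow_of_nonneg _ hp0.le]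
    _ = ((K ^ p) ^ (p / (p - 1)) : ℝ≥0) * ∫⁻ x, ψ x ^ (p / (p - 1)) ∂(volume.withDensity w) := by
        rw [lintegral_const_mul _ (by fun_prop), dens (by fun_prop) hw]
    _ ≤ ((K ^ p) ^ (p / (p - 1)) : ℝ≥0) * (C₂ * ∫⁻ x, (φ x ^ (p - 1) * (w x)⁻¹) ^ (p / (p - 1))
          ∂(volume.withDensity w)) := by
        gcongr
        exact hC₂ _ _ (by fun_prop)
    _ = ((K ^ p) ^ (p / (p - 1)) : ℝ≥0) * (C₂ * ∫⁻ x, φ x ^ p ∂(volume.withDensity σ)) := by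
        congr 2
        rw [dens (by fun_prop) hw, dens (by fun_prop) hσ]
        refine lintegral_congr_ae ?_
        filter_upwards [hw0] with x hx
        rw [ENNReal.mul_rpow_of_nonneg _ _ hq0.le, ← ENNReal.rpow_mul, mul_div_cancel₀ _ hp1.ne',
          mul_assoc, ENNReal.inv_rpow, ← ENNReal.rpow_neg]
        congr 1
        nth_rewrite 2 [← ENNReal.rpow_one (w x)]
        rw [← ENNReal.rpow_add _ _ hx.1 hx.2]
        congr 1
        field_simp
        ring
    _ ≤ ((K ^ p) ^ (p / (p - 1)) : ℝ≥0) * (C₂ * (C₁ * ∫⁻ x, (f x * (σ x)⁻¹) ^ p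
          ∂(volume.withDensity σ))) := by
        gcongr
        exact hC₁ _ _ (by fun_prop)
    _ = _ := by
        push_cast
        rw [mul_assoc, mul_assoc]
        congr 3
        rw [dens (by fun_prop) hσ]
        refine lintegral_congr_ae ?_
        filter_upwards [hw0] with x hx
        rw [ENNReal.mul_rpow_of_nonneg _ _ hp0.le, mul_assoc, ENNReal.inv_rpow]
        congr 1
        simp only [hσdef]
        rw [← ENNReal.rpow_mul, ← ENNReal.rpow_neg, ← ENNReal.rpow_add _ _ hx.1 hx.2]
        conv_rhs => rw [← ENNReal.rpow_one (w x)]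
        congr 1
        field_simp
        ring

/-! ### The Rubio de Francia algorithm -/

/-- One factor `ρ ^ k` is kept inside the `ℓ^q` norm, which bounds each term; the other is summed as
a geometric series. This works for all `q > 0`, below and above 1 alike. -/
theorem tsum_rpow_le_of_geometric {q : ℝ} (hq : 0 < q) {ρ : ℝ≥0∞} (a : ℕ → ℝ≥0∞) :
    (∑' k, ρ ^ (2 * k) * a k) ^ q ≤ ((1 - ρ)⁻¹) ^ q * ∑' k, (ρ ^ k * a k) ^ q := by
  have h : ∀ k, ρ ^ k * a k ≤ (∑' k, (ρ ^ k * a k) ^ q) ^ (1 / q) := fun k => by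
    rw [one_div, ENNReal.le_rpow_inv_iff hq]
    exact ENNReal.le_tsum k
  calc (∑' k, ρ ^ (2 * k) * a k) ^ q
      ≤ (∑' k, ρ ^ k * (∑' k, (ρ ^ k * a k) ^ q) ^ (1 / q)) ^ q := by
        refine ENNReal.rpow_le_rpow (ENNReal.tsum_le_tsum fun k => ?_) hq.le
        rw [two_mul, pow_add, mul_assoc]
        exact mul_le_mul_right (h k) _
    _ = _ := by
        rw [ENNReal.tsum_mul_right, ENNReal.tsum_geometric, ENNReal.mul_rpow_of_nonneg _ _ hq.le,
          ← ENNReal.rpow_mul, one_div_mul_cancel hq.ne', ENNReal.rpow_one]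

theorem intervalMaximal_tsum_le {μ : Measure ℝ} (c : ℕ → ℝ≥0∞) {f : ℕ → ℝ → ℝ≥0∞}
    (hf : ∀ k, Measurable (f k)) (x : ℝ) :
    intervalMaximal μ (fun t => ∑' k, c k * f k t) x ≤ ∑' k, c k * intervalMaximal μ (f k) x := by
  refine iSup₂_le fun I hI => ?_
  rw [lintegral_tsum fun k => ((hf k).const_mul _).aemeasurable, ← ENNReal.tsum_mul_left]
  refine ENNReal.tsum_le_tsum fun k => ?_
  rw [lintegral_const_mul _ (hf k), mul_left_comm]
  exact mul_le_mul_right (le_intervalMaximal μ (f k) I hI) _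

/-- Every point lies in intervals that exhaust the line. This makes the majorant constructed below
strictly positive. -/
theorem intervalMaximal_ne_zero {f : ℝ → ℝ≥0∞} (hf : Measurable f) (h : ¬ ∀ᵐ x, f x = 0)
    (x : ℝ) : intervalMaximal volume f x ≠ 0 := by
  contrapose! h
  have hn : ∀ n : ℕ, ∀ᵐ t, t ∈ Ioo (-(n + |x| + 1)) (n + |x| + 1) → f t = 0 := by
    intro n
    obtain ⟨m, hm⟩ := exists_nat_gt (n + |x| + 1)
    have hx : x ∈ Ioo (((-m : ℚ), (m : ℚ)).1 : ℝ) ((-m : ℚ), (m : ℚ)).2 := by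
      have h1 := abs_lt.1 (show |x| < m by have : (0:ℝ) ≤ n := n.cast_nonneg; linarith)
      simpa using h1
    have h0 := le_intervalMaximal volume f _ hx
    rw [h, nonpos_iff_eq_zero, mul_eq_zero, or_iff_right
      (ENNReal.inv_ne_zero.2 volume_Ioo_ne_top), setLIntegral_eq_zero_iff measurableSet_Ioo hf]
      at h0
    filter_upwards [h0] with t ht h1
    refine ht ?_
    have h2 := h1.1
    have h3 := h1.2
    constructor <;> push_cast <;> linarith
  filter_upwards [ae_all_iff.2 hn] with t ht
  obtain ⟨n, hn⟩ := exists_nat_gt |t|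
  refine ht n ?_
  have h0 := abs_nonneg x
  have h1 := abs_lt.1 hn
  constructor <;> linarith [h1.1, h1.2]

/-- The Rubio de Francia algorithm. -/
theorem exists_isA1_majorant {r : ℝ} (hr : 1 < r) (N : ℝ≥0) :
    ∃ K C : ℝ≥0, ∀ w : ℝ → ℝ≥0∞, Measurable w → (∀ᵐ x, w x ≠ 0 ∧ w x ≠ ⊤) →
      (∀ f : ℝ → ℝ≥0∞, Measurable f →
        ∫⁻ x, intervalMaximal volume f x ^ r * w x ≤ N * ∫⁻ x, f x ^ r * w x) →
      ∀ G : ℝ → ℝ≥0∞, Measurable G → ∫⁻ x, G x ^ r * w x ≠ 0 → ∫⁻ x, G x ^ r * w x ≠ ⊤ →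
        ∃ u, IsA1 K u ∧ (∀ x, G x ≤ u x) ∧ ∫⁻ x, u x ^ r * w x ≤ C * ∫⁻ x, G x ^ r * w x := by
  have hr0 : 0 < r := by linarith
  -- `N` bounds `r`-th powers of norms. Since `L ≥ 1`, `L ^ (-r) * N ≤ L⁻¹ * N ≤ 1`, so `L⁻¹` times
  -- the maximal operator does not increase the norm of `L^r(w)`.
  set L : ℝ≥0 := max N 1 with hL
  have hL0 : (L : ℝ≥0∞) ≠ 0 := by
    have : L ≠ 0 := (lt_of_lt_of_le one_pos (le_max_right N 1)).ne'
    exact_mod_cast this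
  have hLt : (L : ℝ≥0∞) ≠ ⊤ := ENNReal.coe_ne_top
  have hsum : ∑' k : ℕ, ((2 : ℝ≥0∞)⁻¹ ^ r) ^ k ≠ ⊤ := by
    rw [ENNReal.tsum_geometric]
    refine ENNReal.inv_ne_top.2 (tsub_pos_of_lt ?_).ne'
    exact ENNReal.rpow_lt_one (by simp) hr0
  refine ⟨4 * L, ((1 - (2 : ℝ≥0∞)⁻¹)⁻¹ ^ r * ∑' k : ℕ, ((2 : ℝ≥0∞)⁻¹ ^ r) ^ k).toNNReal,
    fun w hw hw0 hN G hG hG0 hGt => ?_⟩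
  let a : ℕ → ℝ → ℝ≥0∞ := fun k =>
    Nat.rec G (fun _ g x => (L : ℝ≥0∞)⁻¹ * intervalMaximal volume g x) k
  have ha0 : a 0 = G := rfl
  have ha1 : ∀ k x, a (k + 1) x = (L : ℝ≥0∞)⁻¹ * intervalMaximal volume (a k) x := fun _ _ => rfl
  have ham : ∀ k, Measurable (a k) := by
    intro k
    cases k with
    | zero => exact hG
    | succ k => exact (measurable_intervalMaximal volume (a k)).const_mul _
  have hMa : ∀ k x, intervalMaximal volume (a k) x = L * a (k + 1) x := fun k x => by
    rw [ha1, ← mul_assoc, ENNReal.mul_inv_cancel hL0 hLt, one_mul]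
  have haint : ∀ k, ∫⁻ x, a k x ^ r * w x ≤ ∫⁻ x, G x ^ r * w x := by
    intro k
    induction k with
    | zero => rfl
    | succ k ih =>
      refine le_trans ?_ ih
      simp_rw [ha1, ENNReal.mul_rpow_of_nonneg _ _ hr0.le, mul_assoc]
      have hMm := measurable_intervalMaximal volume (a k)
      rw [lintegral_const_mul _ (by fun_prop)]
      calc _ ≤ (L : ℝ≥0∞)⁻¹ ^ (1 : ℝ) * (N * ∫⁻ x, a k x ^ r * w x) := by
            refine mul_le_mul' ?_ (hN _ (ham k))
            refine ENNReal.rpow_le_rpow_of_exponent_ge ?_ hr.le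
            rw [ENNReal.inv_le_one]
            exact_mod_cast le_max_right N 1
        _ ≤ (L : ℝ≥0∞)⁻¹ * (L * ∫⁻ x, a k x ^ r * w x) := by
            rw [ENNReal.rpow_one]
            gcongr
            exact le_max_left N 1
        _ = _ := by rw [← mul_assoc, ENNReal.inv_mul_cancel hL0 hLt, one_mul]
  -- Applying the maximal operator shifts the series by one index at the cost of `4 * L`, which is
  -- the `A₁` constant. The weights `4 ^ (-k)` are written as squares to fit
  -- `tsum_rpow_le_of_geometric`.
  set u : ℝ → ℝ≥0∞ := fun x => ∑' k, (2 : ℝ≥0∞)⁻¹ ^ (2 * k) * a k x with hu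
  have hum : Measurable u := Measurable.tsum fun k => (ham k).const_mul _
  have huint : ∫⁻ x, u x ^ r * w x ≤ ((1 - (2 : ℝ≥0∞)⁻¹)⁻¹ ^ r *
      ∑' k : ℕ, ((2 : ℝ≥0∞)⁻¹ ^ r) ^ k) * ∫⁻ x, G x ^ r * w x := by
    calc ∫⁻ x, u x ^ r * w x ≤ ∫⁻ x, (1 - (2 : ℝ≥0∞)⁻¹)⁻¹ ^ r *
          ∑' k, ((2 : ℝ≥0∞)⁻¹ ^ k) ^ r * (a k x ^ r * w x) := by
          refine lintegral_mono fun x => ?_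
          refine (mul_le_mul_left (tsum_rpow_le_of_geometric hr0 _) _).trans_eq ?_
          rw [mul_assoc, ← ENNReal.tsum_mul_right]
          congr! 3 with k
          rw [ENNReal.mul_rpow_of_nonneg _ _ hr0.le, mul_assoc]
      _ = (1 - (2 : ℝ≥0∞)⁻¹)⁻¹ ^ r *
          ∑' k, ((2 : ℝ≥0∞)⁻¹ ^ k) ^ r * ∫⁻ x, a k x ^ r * w x := by
          have hm : ∀ k, Measurable fun x => a k x ^ r * w x := fun k =>
            ((ham k).pow_const r).mul hw
          rw [lintegral_const_mul _ (Measurable.tsum fun k => (hm k).const_mul _),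
            lintegral_tsum fun k => ((hm k).const_mul _).aemeasurable]
          simp_rw [lintegral_const_mul _ (hm _)]
      _ ≤ (1 - (2 : ℝ≥0∞)⁻¹)⁻¹ ^ r *
          ∑' k, ((2 : ℝ≥0∞)⁻¹ ^ k) ^ r * ∫⁻ x, G x ^ r * w x := by
          exact mul_le_mul_right (ENNReal.tsum_le_tsum fun k => mul_le_mul_right (haint k) _) _
      _ = _ := by
          rw [ENNReal.tsum_mul_right, mul_assoc]
          congr! 4 with k
          rw [← ENNReal.rpow_natCast, ← ENNReal.rpow_mul, mul_comm, ENNReal.rpow_mul,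
            ENNReal.rpow_natCast]
  have hCt : (1 - (2 : ℝ≥0∞)⁻¹)⁻¹ ^ r * ∑' k : ℕ, ((2 : ℝ≥0∞)⁻¹ ^ r) ^ k ≠ ⊤ := by
    refine ENNReal.mul_ne_top (ENNReal.rpow_ne_top_of_nonneg hr0.le ?_) hsum
    simp
  refine ⟨u, ⟨hum, fun x => ?_, ?_, ?_⟩, fun x => ?_, ?_⟩
  · refine (intervalMaximal_tsum_le _ ham x).trans ?_
    simp_rw [hMa]
    have h4 : (2 : ℝ≥0∞)⁻¹ ^ 2 * 4 = 1 := by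
      rw [← ENNReal.inv_pow]
      norm_num
      exact ENNReal.inv_mul_cancel (by norm_num) (by norm_num)
    calc ∑' k, (2 : ℝ≥0∞)⁻¹ ^ (2 * k) * (L * a (k + 1) x)
        = (4 * L) * ∑' k, (2 : ℝ≥0∞)⁻¹ ^ (2 * (k + 1)) * a (k + 1) x := by
          rw [← ENNReal.tsum_mul_left]
          refine tsum_congr fun k => ?_
          rw [mul_add, mul_one, pow_add]
          calc _ = (2 : ℝ≥0∞)⁻¹ ^ (2 * k) * (L * a (k + 1) x) * 1 := by rw [mul_one]
            _ = _ := by rw [← h4]; ring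
      _ ≤ _ := by
          push_cast
          gcongr
          exact ENNReal.tsum_comp_le_tsum_of_injective (add_left_injective 1)
            (fun k => (2 : ℝ≥0∞)⁻¹ ^ (2 * k) * a k x)
  -- The term `k = 1` is a multiple of the maximal function of `G`, which vanishes nowhere.
  · refine Filter.Eventually.of_forall fun x hx => ?_
    have h1 := (ENNReal.tsum_eq_zero.1 hx) 1
    rw [mul_eq_zero, or_iff_right (by simp), show a 1 x = _ from ha1 0 x, mul_eq_zero,
      or_iff_right (ENNReal.inv_ne_zero.2 hLt)] at h1
    refine intervalMaximal_ne_zero hG (fun h => hG0 ?_) x h1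
    rw [lintegral_eq_zero_iff (by fun_prop)]
    filter_upwards [h] with x hx
    simp [hx, hr0]
  · have h1 : ∀ᵐ x, u x ^ r * w x < ⊤ :=
      ae_lt_top (by fun_prop) (ne_top_of_le_ne_top (ENNReal.mul_ne_top hCt hGt) huint)
    filter_upwards [h1, hw0] with x hx hwx h
    rw [h, ENNReal.top_rpow_of_pos hr0, ENNReal.top_mul hwx.1] at hx
    exact lt_irrefl _ hx
  · have := ENNReal.le_tsum (f := fun k => (2 : ℝ≥0∞)⁻¹ ^ (2 * k) * a k x) 0
    simpa [ha0] using this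
  · rwa [ENNReal.coe_toNNReal hCt]

/-! ### Weighted bounds and extrapolation -/

/-- The pair `(F, G)` satisfies weighted `L^r` bounds for all `r > 1` and all weights `u^{1 - r} v`
with `u` and `v` in `A₁`, with constants given by `B`. -/
def WeightedBound (B : ℝ → ℝ≥0 → ℝ≥0) (F G : ℝ → ℝ≥0∞) : Prop :=
  ∀ r : ℝ, 1 < r → ∀ (K : ℝ≥0) (u v : ℝ → ℝ≥0∞), IsA1 K u → IsA1 K v →
    ∫⁻ x, F x ^ r * apWeight r u v x ≤ B r K * ∫⁻ x, G x ^ r * apWeight r u v x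

theorem exists_weightedBound_intervalMaximal :
    ∃ B, ∀ f : ℝ → ℝ≥0∞, Measurable f → WeightedBound B (intervalMaximal volume f) f := by
  have : ∀ (r : ℝ) (K : ℝ≥0), ∃ C : ℝ≥0, 1 < r → ∀ u v f : ℝ → ℝ≥0∞, IsA1 K u → IsA1 K v →
      Measurable f → ∫⁻ x, intervalMaximal volume f x ^ r * apWeight r u v x ≤
        C * ∫⁻ x, f x ^ r * apWeight r u v x := by
    intro r K
    by_cases hr : 1 < r
    · obtain ⟨C, hC⟩ := exists_lintegral_intervalMaximal_rpow_mul_apWeight_le hr K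
      exact ⟨C, fun _ => hC⟩
    · exact ⟨0, fun h => absurd h hr⟩
  choose B hB using this
  exact ⟨B, fun f hf r hr K u v hu hv => hB r K hr u v f hu hv hf⟩

/-- Since `(p - 1) * (q - 1) = 1`, the dual weight is again factored, so Muckenhoupt's theorem and
the majorant construction also apply on the dual side. -/
theorem apWeight_dual {K : ℝ≥0} {u v : ℝ → ℝ≥0∞} {p q : ℝ} (hpq : p.HolderConjugate q)
    (hu : IsA1 K u) (hv : IsA1 K v) :
    ∀ᵐ x, apWeight q v u x = apWeight p u v x ^ (1 - q) := by
  filter_upwards [hu.ne_zero, hu.ne_top, hv.ne_zero, hv.ne_top] with x h1 h2 h3 h4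
  rw [apWeight, apWeight, ENNReal.mul_rpow_of_ne_top (ENNReal.rpow_ne_top_of_ne_zero h1 h2) h4,
    ← ENNReal.rpow_mul, mul_comm]
  congr 1
  conv_lhs => rw [← ENNReal.rpow_one (u x)]
  congr 1
  have := hpq.mul_eq_add
  linarith

/-- The heart of extrapolation, for a function `F` with finite norm. -/
theorem exists_extrapolate_of_ne_top {s r : ℝ} (hs : 1 < s) (hr : 1 < r) (b : ℝ≥0 → ℝ≥0)
    (K : ℝ≥0) :
    ∃ C : ℝ≥0, ∀ F G : ℝ → ℝ≥0∞, Measurable F → Measurable G →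
      (∀ (K : ℝ≥0) (u v : ℝ → ℝ≥0∞), IsA1 K u → IsA1 K v →
        ∫⁻ x, F x ^ s * apWeight s u v x ≤ b K * ∫⁻ x, G x ^ s * apWeight s u v x) →
      ∀ u v : ℝ → ℝ≥0∞, IsA1 K u → IsA1 K v →
        ∫⁻ x, F x ^ r * apWeight r u v x ≠ ⊤ →
        ∫⁻ x, F x ^ r * apWeight r u v x ≤ C * ∫⁻ x, G x ^ r * apWeight r u v x := by
  have hr0 : 0 < r := by linarith
  have hs0 : 0 < s := by linarith
  set q := r.conjExponent with hq
  have hrq : r.HolderConjugate q := Real.HolderConjugate.conjExponent hr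
  have hsq : s.HolderConjugate s.conjExponent := Real.HolderConjugate.conjExponent hs
  have hq0 : 0 < q := hrq.symm.pos
  have hs1 : 1 / s.conjExponent = 1 - 1 / s := by
    have := hsq.one_div_add_one_div
    rw [div_one] at this
    linarith
  have hr1 : 1 / q = 1 - 1 / r := by
    have := hrq.one_div_add_one_div
    rw [div_one] at this
    linarith
  obtain ⟨N₁, hN₁⟩ := exists_lintegral_intervalMaximal_rpow_mul_apWeight_le hr K
  obtain ⟨N₂, hN₂⟩ := exists_lintegral_intervalMaximal_rpow_mul_apWeight_le hrq.symm.lt K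
  obtain ⟨K₁, C₁, h₁⟩ := exists_isA1_majorant hr N₁
  obtain ⟨K₂, C₂, h₂⟩ := exists_isA1_majorant hrq.symm.lt N₂
  set b' : ℝ≥0 := b (max K₁ K₂) with hb'
  -- The maximum with 1 keeps `A` nonzero, so that the bound is trivial when the norm of `G` is
  -- infinite.
  set A : ℝ≥0 := max (b' ^ (1 / s) * C₁ ^ (1 / r) * C₂ ^ (1 / q)) 1 with hA
  refine ⟨A ^ r, fun F G hF hG hFG u v hu hv hX => ?_⟩
  set w := apWeight r u v with hwdef
  have hw : Measurable w := measurable_apWeight r hu.measurable hv.measurable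
  have hw0 : ∀ᵐ x, w x ≠ 0 ∧ w x ≠ ⊤ := hu.apWeight_ne r hv
  set w' := apWeight q v u with hwdef'
  have hw' : Measurable w' := measurable_apWeight q hv.measurable hu.measurable
  have hw0' : ∀ᵐ x, w' x ≠ 0 ∧ w' x ≠ ⊤ := hv.apWeight_ne q hu
  have hww : ∀ᵐ x, w' x = w x ^ (1 - q) := apWeight_dual hrq hu hv
  set X := ∫⁻ x, F x ^ r * w x with hXdef
  set Y := ∫⁻ x, G x ^ r * w x with hYdef
  by_cases hX0 : X = 0
  · rw [hX0]; exact bot_le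
  have hFne : ¬ ∀ᵐ x, F x = 0 := by
    intro h
    refine hX0 ((lintegral_eq_zero_iff (by fun_prop)).2 ?_)
    filter_upwards [h] with x hx
    simp [hx, hr0]
  by_cases hY0 : Y = 0
  · exfalso
    -- If `G` vanishes almost everywhere, so does `F`, by the hypothesis at `s` with weight 1.
    have hGz : ∀ᵐ x, G x = 0 := by
      have := (lintegral_eq_zero_iff (by fun_prop)).1 hY0
      filter_upwards [this, hw0] with x h1 h2
      rw [Pi.zero_apply, mul_eq_zero, or_iff_left h2.1, ENNReal.rpow_eq_zero_iff_of_pos hr0] at h1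
      exact h1
    have h := hFG 1 _ _ isA1_one isA1_one
    have hone : Measurable (apWeight s (fun _ => 1) (fun _ => 1)) :=
      measurable_apWeight s measurable_const measurable_const
    have h0 : ∫⁻ x, G x ^ s * apWeight s (fun _ => 1) (fun _ => 1) x = 0 := by
      rw [lintegral_eq_zero_iff (by fun_prop)]
      filter_upwards [hGz] with x hx
      simp [hx, hs0]
    rw [h0, mul_zero, nonpos_iff_eq_zero, lintegral_eq_zero_iff (by fun_prop)] at h
    apply hFne
    filter_upwards [h] with x hx
    simpa [apWeight, hs0, hs0.le, not_lt.2 hs0.le] using hx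
  by_cases hYt : Y = ⊤
  · rw [hYt]
    have hA0 : A ^ r ≠ 0 :=
      (NNReal.rpow_pos (lt_of_lt_of_le one_pos (le_max_right _ _))).ne'
    rw [ENNReal.mul_top (by exact_mod_cast hA0)]
    exact le_top
  -- `H` is the function dual to `F`: both its pairing with `F` and its `q`-th power integral
  -- against `w'` equal `X`.
  set H : ℝ → ℝ≥0∞ := fun x => F x ^ (r - 1) * w x with hH
  have hHm : Measurable H := by fun_prop
  have hHX : ∫⁻ x, H x ^ q * w' x = X := by
    refine lintegral_congr_ae ?_
    filter_upwards [hw0, hww] with x h1 h2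
    rw [h2, hH, ENNReal.mul_rpow_of_nonneg _ _ hq0.le, ← ENNReal.rpow_mul, mul_assoc,
      ← ENNReal.rpow_add _ _ h1.1 h1.2, add_sub_cancel, ENNReal.rpow_one]
    congr 2
    have := hrq.mul_eq_add
    linarith
  have hFH : ∫⁻ x, F x * H x = X := by
    refine lintegral_congr fun x => ?_
    rw [hH, ← mul_assoc]
    congr 1
    by_cases h0 : F x = 0
    · simp [h0, hr0]
    by_cases ht : F x = ⊤
    · simp [ht, hr0, hr]
    nth_rewrite 1 [← ENNReal.rpow_one (F x)]
    rw [← ENNReal.rpow_add _ _ h0 ht]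
    congr 1
    ring
  obtain ⟨g, hgA, hGg, hgint⟩ := h₁ w hw hw0 (fun f hf => hN₁ u v f hu hv hf) G hG hY0 hYt
  obtain ⟨h, hhA, hHh, hhint⟩ := h₂ w' hw' hw0' (fun f hf => hN₂ v u f hv hu hf) H hHm
    (by rwa [hHX]) (by rwa [hHX])
  rw [hHX] at hhint
  have hgm := hgA.measurable
  have hhm := hhA.measurable
  set Z := ∫⁻ x, g x * h x with hZ
  have hZle : Z ≤ (C₁ * Y) ^ (1 / r) * (C₂ * X) ^ (1 / q) := by
    calc Z = ∫⁻ x, (fun x => g x * w x ^ (1 / r)) x * (fun x => h x * w x ^ (-(1 / r))) x := by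
          refine lintegral_congr_ae ?_
          filter_upwards [hw0] with x hx
          have : w x ^ (1 / r) * w x ^ (-(1 / r)) = 1 := by
            rw [← ENNReal.rpow_add _ _ hx.1 hx.2, add_neg_cancel, ENNReal.rpow_zero]
          calc g x * h x = g x * h x * (w x ^ (1 / r) * w x ^ (-(1 / r))) := by rw [this, mul_one]
            _ = _ := by ring
      _ ≤ (∫⁻ x, (g x * w x ^ (1 / r)) ^ r) ^ (1 / r) *
          (∫⁻ x, (h x * w x ^ (-(1 / r))) ^ q) ^ (1 / q) :=
          ENNReal.lintegral_mul_le_Lp_mul_Lq volume hrq (by fun_prop) (by fun_prop)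
      _ = (∫⁻ x, g x ^ r * w x) ^ (1 / r) * (∫⁻ x, h x ^ q * w' x) ^ (1 / q) := by
          congr 2
          · refine lintegral_congr fun x => ?_
            rw [ENNReal.mul_rpow_of_nonneg _ _ hr0.le, ← ENNReal.rpow_mul,
              one_div_mul_cancel hr0.ne', ENNReal.rpow_one]
          · refine lintegral_congr_ae ?_
            filter_upwards [hww] with x hx
            rw [ENNReal.mul_rpow_of_nonneg _ _ hq0.le, ← ENNReal.rpow_mul, hx]
            congr 2
            have := hrq.mul_eq_add
            field_simp
            linarith
      _ ≤ _ := by gcongr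
  have hXle : X ≤ b' ^ (1 / s) * Z := by
    calc X ≤ ∫⁻ x, F x * h x := by rw [← hFH]; gcongr with x; exact hHh x
      -- Hölder at exponent `s` is arranged so that the first factor carries the weight `g ^ (1 - s)
      -- * h`, built from the two majorants, to which the hypothesis at `s` applies.
      _ = ∫⁻ x, (fun x => F x * g x ^ ((1 - s) / s) * h x ^ (1 / s)) x *
          (fun x => (g x * h x) ^ (1 / s.conjExponent)) x := by
          refine lintegral_congr_ae ?_
          filter_upwards [hgA.ne_zero, hgA.ne_top, hhA.ne_zero, hhA.ne_top] with x h1 h2 h3 h4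
          have e1 : g x ^ ((1 - s) / s) * g x ^ (1 / s.conjExponent) = 1 := by
            rw [← ENNReal.rpow_add _ _ h1 h2, hs1, ← ENNReal.rpow_zero (x := g x)]
            congr 1
            field_simp
            ring
          have e2 : h x ^ (1 / s) * h x ^ (1 / s.conjExponent) = h x := by
            rw [← ENNReal.rpow_add _ _ h3 h4, hs1]
            conv_rhs => rw [← ENNReal.rpow_one (h x)]
            congr 1
            field_simp
            ring
          rw [ENNReal.mul_rpow_of_nonneg _ _ (by have := hsq.symm.pos; positivity)]
          calc F x * h x = F x * (1 * h x) := by rw [one_mul]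
            _ = F x * ((g x ^ ((1 - s) / s) * g x ^ (1 / s.conjExponent)) *
                (h x ^ (1 / s) * h x ^ (1 / s.conjExponent))) := by rw [e1, e2]
            _ = _ := by ring
      _ ≤ (∫⁻ x, (F x * g x ^ ((1 - s) / s) * h x ^ (1 / s)) ^ s) ^ (1 / s) *
          (∫⁻ x, ((g x * h x) ^ (1 / s.conjExponent)) ^ s.conjExponent) ^
            (1 / s.conjExponent) :=
          ENNReal.lintegral_mul_le_Lp_mul_Lq volume hsq (by fun_prop) (by fun_prop)
      _ = (∫⁻ x, F x ^ s * apWeight s g h x) ^ (1 / s) * Z ^ (1 / s.conjExponent) := by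
          congr 2
          · refine lintegral_congr fun x => ?_
            rw [ENNReal.mul_rpow_of_nonneg _ _ hs0.le, ENNReal.mul_rpow_of_nonneg _ _ hs0.le,
              ← ENNReal.rpow_mul, ← ENNReal.rpow_mul, one_div_mul_cancel hs0.ne',
              ENNReal.rpow_one, div_mul_cancel₀ _ hs0.ne', apWeight, mul_assoc]
          · refine lintegral_congr fun x => ?_
            rw [← ENNReal.rpow_mul, one_div_mul_cancel hsq.symm.ne_zero, ENNReal.rpow_one]
      _ ≤ (b' * ∫⁻ x, G x ^ s * apWeight s g h x) ^ (1 / s) * Z ^ (1 / s.conjExponent) := by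
          have := hFG (max K₁ K₂) g h (hgA.mono (le_max_left _ _)) (hhA.mono (le_max_right _ _))
          gcongr
      _ ≤ (b' * Z) ^ (1 / s) * Z ^ (1 / s.conjExponent) := by
          refine mul_le_mul_left (ENNReal.rpow_le_rpow (mul_le_mul_right ?_ _) (by positivity)) _
          refine lintegral_mono_ae ?_
          filter_upwards [hgA.ne_zero, hgA.ne_top] with x h1 h2
          rw [apWeight, ← mul_assoc]
          gcongr
          calc G x ^ s * g x ^ (1 - s) ≤ g x ^ s * g x ^ (1 - s) := by gcongr; exact hGg x
            _ = g x := by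
              rw [← ENNReal.rpow_add _ _ h1 h2, add_sub_cancel, ENNReal.rpow_one]
      _ = b' ^ (1 / s) * Z := by
          rw [ENNReal.mul_rpow_of_nonneg _ _ (by positivity), mul_assoc,
            ← ENNReal.rpow_add_of_nonneg _ _ (by positivity)
              (by have := hsq.symm.pos; positivity)]
          have := hsq.one_div_add_one_div
          rw [this]
          simp
  have hfin : X ≤ A * Y ^ (1 / r) * X ^ (1 / q) := by
    have hle : ((b' ^ (1 / s) * C₁ ^ (1 / r) * C₂ ^ (1 / q) : ℝ≥0) : ℝ≥0∞) ≤ A := by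
      exact_mod_cast le_max_left _ _
    refine le_trans ?_ (mul_le_mul_left (mul_le_mul_left hle _) _)
    refine (hXle.trans (mul_le_mul_right hZle _)).trans_eq ?_
    rw [ENNReal.mul_rpow_of_nonneg _ _ (by positivity), ENNReal.mul_rpow_of_nonneg _ _
      (by positivity)]
    push_cast
    rw [ENNReal.coe_rpow_of_nonneg _ (by positivity), ENNReal.coe_rpow_of_nonneg _ (by positivity),
      ENNReal.coe_rpow_of_nonneg _ (by positivity)]
    ring
  -- Dividing by `X ^ (1 / q)` is where the finiteness of `X` is needed.
  have hXr : X ^ (1 / r) ≤ A * Y ^ (1 / r) := by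
    have e : X ^ (1 / r) = X / X ^ (1 / q) := by
      rw [← ENNReal.rpow_one X, ← ENNReal.rpow_mul, ← ENNReal.rpow_mul,
        ← ENNReal.rpow_sub _ _ hX0 hX, hr1]
      congr 1
      ring
    rw [e]
    exact ENNReal.div_le_of_le_mul hfin
  have := ENNReal.rpow_le_rpow hXr hr0.le
  rw [ENNReal.mul_rpow_of_nonneg _ _ hr0.le, ← ENNReal.rpow_mul, ← ENNReal.rpow_mul,
    one_div_mul_cancel hr0.ne', ENNReal.rpow_one, ENNReal.rpow_one] at this
  rwa [ENNReal.coe_rpow_of_nonneg _ hr0.le]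

theorem IsA1.setLIntegral_apWeight_ne_top {K : ℝ≥0} {u v : ℝ → ℝ≥0∞} {p : ℝ} (hp : 1 < p)
    (hu : IsA1 K u) (hv : IsA1 K v) {I : ℚ × ℚ} (hI : I.1 < I.2) :
    ∫⁻ t in Ioo (I.1 : ℝ) I.2, apWeight p u v t ≠ ⊤ := by
  have h := hu.setLIntegral_rpow_neg_mul_le hv hI (sub_pos.2 hp).le
  simp only [neg_sub] at h
  refine ne_top_of_le_ne_top (ENNReal.mul_ne_top ?_ (hv.setLIntegral_ne_top hI)) h
  refine ENNReal.rpow_ne_top_of_ne_zero (mul_ne_zero ?_ (hu.setLIntegral_ne_zero hI))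
    (ENNReal.mul_ne_top ?_ (hu.setLIntegral_ne_top hI))
  · exact ENNReal.inv_ne_zero.2 (ENNReal.mul_ne_top volume_Ioo_ne_top ENNReal.coe_ne_top)
  · refine ENNReal.inv_ne_top.2 (mul_ne_zero (volume_Ioo_ne_zero hI) ?_)
    intro hK
    obtain ⟨x, hx⟩ : (Ioo (I.1 : ℝ) I.2).Nonempty := nonempty_Ioo.2 (by exact_mod_cast hI)
    have := hu.setLIntegral_le hI hx
    rw [hK, zero_mul, mul_zero] at this
    exact hu.setLIntegral_ne_zero hI (le_antisymm this bot_le)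

/-- Extrapolation from a single exponent `s` to all exponents. -/
theorem exists_weightedBound_of_single {s : ℝ} (hs : 1 < s) (b : ℝ≥0 → ℝ≥0) :
    ∃ B, ∀ F G : ℝ → ℝ≥0∞, Measurable F → Measurable G →
      (∀ (K : ℝ≥0) (u v : ℝ → ℝ≥0∞), IsA1 K u → IsA1 K v →
        ∫⁻ x, F x ^ s * apWeight s u v x ≤ b K * ∫⁻ x, G x ^ s * apWeight s u v x) →
      WeightedBound B F G := by
  have : ∀ (r : ℝ) (K : ℝ≥0), ∃ C : ℝ≥0, 1 < r → ∀ F G : ℝ → ℝ≥0∞, Measurable F →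
      Measurable G → (∀ (K : ℝ≥0) (u v : ℝ → ℝ≥0∞), IsA1 K u → IsA1 K v →
        ∫⁻ x, F x ^ s * apWeight s u v x ≤ b K * ∫⁻ x, G x ^ s * apWeight s u v x) →
      ∀ u v : ℝ → ℝ≥0∞, IsA1 K u → IsA1 K v →
        ∫⁻ x, F x ^ r * apWeight r u v x ≠ ⊤ →
        ∫⁻ x, F x ^ r * apWeight r u v x ≤ C * ∫⁻ x, G x ^ r * apWeight r u v x := by
    intro r K
    by_cases hr : 1 < r
    · obtain ⟨C, hC⟩ := exists_extrapolate_of_ne_top hs hr b K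
      exact ⟨C, fun _ => hC⟩
    · exact ⟨0, fun h => absurd h hr⟩
  choose B hB using this
  refine ⟨B, fun F G hF hG hFG r hr K u v hu hv => ?_⟩
  have hr0 : 0 < r := by linarith
  have hw := measurable_apWeight r hu.measurable hv.measurable
  -- Truncations of `F` in height and support inherit the hypothesis with the same `G` and have
  -- finite norm; monotone convergence recovers `F`.
  let T : ℕ → ℝ → ℝ≥0∞ := fun m => (Ioo (-m : ℝ) m).indicator fun x => min (F x) m
  have hTm : ∀ m, Measurable (T m) := fun m =>
    (hF.min measurable_const).indicator measurableSet_Ioo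
  have hTF : ∀ m x, T m x ≤ F x := fun m x =>
    (indicator_le_self _ _ x).trans (min_le_left _ _)
  have hTmono : ∀ x, Monotone fun m => T m x := by
    intro x m k hmk
    have hmk' : (m : ℝ) ≤ k := by exact_mod_cast hmk
    by_cases hx : x ∈ Ioo (-m : ℝ) m
    · have hx' : x ∈ Ioo (-k : ℝ) k := Ioo_subset_Ioo (neg_le_neg hmk') hmk' hx
      simp only [T, indicator_of_mem hx, indicator_of_mem hx']
      gcongr
    · simp [T, indicator_of_notMem hx]
  have hTlim : ∀ x, Filter.Tendsto (fun m => T m x) Filter.atTop (nhds (F x)) := by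
    intro x
    have h1 : Filter.Tendsto (fun m : ℕ => min (F x) (m : ℝ≥0∞)) Filter.atTop (nhds (F x)) := by
      have := (tendsto_const_nhds (x := F x)).min ENNReal.tendsto_nat_nhds_top
      rwa [min_top_right] at this
    refine h1.congr' ?_
    obtain ⟨n, hn⟩ := exists_nat_gt |x|
    filter_upwards [Filter.eventually_ge_atTop n] with m hm
    have hm' : (n : ℝ) ≤ m := by exact_mod_cast hm
    have hx : x ∈ Ioo (-m : ℝ) m := abs_lt.1 (hn.trans_le hm')
    exact (indicator_of_mem hx fun y => min (F y) (m : ℝ≥0∞)).symm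
  have hle : ∀ m, ∫⁻ x, T m x ^ r * apWeight r u v x ≤
      B r K * ∫⁻ x, G x ^ r * apWeight r u v x := by
    intro m
    refine hB r K hr (T m) G (hTm m) hG (fun K' u' v' hu' hv' => ?_) u v hu hv ?_
    · refine le_trans (lintegral_mono fun x => ?_) (hFG K' u' v' hu' hv')
      exact mul_le_mul_left (ENNReal.rpow_le_rpow (hTF m x) (by linarith)) _
    -- The enlargement by 1 keeps the interval nonempty when `m = 0`.
    · have hI : (-(m + 1 : ℚ), (m + 1 : ℚ)).1 < (-(m + 1 : ℚ), (m + 1 : ℚ)).2 := by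
        have : (0 : ℚ) ≤ m := m.cast_nonneg
        simp only
        linarith
      refine ne_top_of_le_ne_top (ENNReal.mul_ne_top
        (ENNReal.rpow_ne_top_of_nonneg hr0.le (ENNReal.natCast_ne_top m))
        (hu.setLIntegral_apWeight_ne_top hr hv hI)) ?_
      rw [← lintegral_const_mul _ hw, ← lintegral_indicator measurableSet_Ioo]
      refine lintegral_mono fun x => ?_
      by_cases hx : x ∈ Ioo (-m : ℝ) m
      · rw [indicator_of_mem]
        · refine mul_le_mul_left (ENNReal.rpow_le_rpow ?_ hr0.le) _
          exact (indicator_of_mem hx _).trans_le (min_le_right _ _)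
        · push_cast
          exact ⟨by linarith [hx.1], by linarith [hx.2]⟩
      · simp [T, indicator_of_notMem hx, hr0]
  refine le_of_tendsto' (lintegral_tendsto_of_tendsto_of_monotone (fun m => ?_) ?_ ?_) hle
  · exact (((hTm m).pow_const r).mul hw).aemeasurable
  · exact Filter.Eventually.of_forall fun x m k hmk =>
      mul_le_mul_left (ENNReal.rpow_le_rpow (hTmono x hmk) hr0.le) _
  · filter_upwards [hu.apWeight_ne r hv] with x hx
    refine ENNReal.Tendsto.mul_const ?_ (Or.inr hx.2)
    exact (ENNReal.continuous_rpow_const.tendsto _).comp (hTlim x)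

/-- Weighted bounds are inherited by `L^s` norms of families of functions. -/
theorem exists_weightedBound_lintegral {s : ℝ} (hs : 1 < s) (B : ℝ → ℝ≥0 → ℝ≥0) :
    ∃ B', ∀ {Ω : Type} [MeasurableSpace Ω] (μ : Measure Ω) [SFinite μ] (F G : Ω → ℝ → ℝ≥0∞),
      Measurable (Function.uncurry F) → Measurable (Function.uncurry G) →
      (∀ ω, WeightedBound B (F ω) (G ω)) →
      WeightedBound B' (fun t => (∫⁻ ω, F ω t ^ s ∂μ) ^ (1 / s))
        (fun t => (∫⁻ ω, G ω t ^ s ∂μ) ^ (1 / s)) := by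
  obtain ⟨B', hB'⟩ := exists_weightedBound_of_single hs (B s)
  have hs0 : s ≠ 0 := by linarith
  refine ⟨B', fun {Ω} _ μ _ F G hF hG h => hB' _ _ ?_ ?_ fun K u v hu hv => ?_⟩
  · exact (Measurable.lintegral_prod_left' (f := fun z : Ω × ℝ => F z.1 z.2 ^ s)
      (hF.pow_const s)).pow_const _
  · exact (Measurable.lintegral_prod_left' (f := fun z : Ω × ℝ => G z.1 z.2 ^ s)
      (hG.pow_const s)).pow_const _
  · have hw := measurable_apWeight s hu.measurable hv.measurable
    -- At the exponent `s` the inner norm cancels and Tonelli reduces the claim to each parameter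
    -- `ω`.
    have key : ∀ F : Ω → ℝ → ℝ≥0∞, Measurable (Function.uncurry F) →
        ∫⁻ x, ((∫⁻ ω, F ω x ^ s ∂μ) ^ (1 / s)) ^ s * apWeight s u v x =
          ∫⁻ ω, ∫⁻ x, F ω x ^ s * apWeight s u v x ∂volume ∂μ := by
      intro F hF
      rw [lintegral_lintegral_swap]
      · refine lintegral_congr fun x => ?_
        rw [← ENNReal.rpow_mul, one_div_mul_cancel hs0, ENNReal.rpow_one, lintegral_mul_const]
        exact (hF.comp (measurable_id.prodMk measurable_const)).pow_const s
      · exact ((hF.pow_const s).mul (hw.comp measurable_snd)).aemeasurable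
    rw [key F hF, key G hG, ← lintegral_const_mul]
    · exact lintegral_mono fun ω => h ω s hs K u v hu hv
    · exact Measurable.lintegral_prod_right'
        (f := fun z : Ω × ℝ => G z.1 z.2 ^ s * apWeight s u v z.2)
        ((hG.pow_const s).mul (hw.comp measurable_snd))

theorem WeightedBound.lintegral_rpow_le {B : ℝ → ℝ≥0 → ℝ≥0} {F G : ℝ → ℝ≥0∞}
    (h : WeightedBound B F G) {r : ℝ} (hr : 1 < r) :
    ∫⁻ x, F x ^ r ≤ B r 1 * ∫⁻ x, G x ^ r := by
  simpa [apWeight] using h r hr 1 _ _ isA1_one isA1_one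

/-! ### Mixed Lebesgue norms -/

theorem eLpNorm_eq_lintegral_rpow {α : Type*} [MeasurableSpace α] (μ : Measure α) {p : ℝ≥0∞}
    (hp : 1 < p ∧ p < ∞) (f : α → ℝ≥0∞) :
    eLpNorm f p μ = (∫⁻ x, f x ^ p.toReal ∂μ) ^ (1 / p.toReal) := by
  rw [eLpNorm_eq_lintegral_rpow_enorm_toReal (zero_lt_one.trans hp.1).ne' hp.2.ne]
  simp only [enorm_eq_self]

theorem one_lt_toReal {p : ℝ≥0∞} (hp : 1 < p ∧ p < ∞) : 1 < p.toReal := by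
  have := (ENNReal.toReal_lt_toReal ENNReal.one_ne_top hp.2.ne).2 hp.1
  simpa using this

theorem measurable_cons (n : ℕ) :
    Measurable fun z : ℝ × (Fin n → ℝ) => (Fin.cons z.1 z.2 : Fin (n + 1) → ℝ) := by
  refine measurable_pi_iff.2 fun i => ?_
  refine Fin.cases ?_ (fun i => ?_) i
  · simpa using measurable_fst
  · simpa [Function.comp_def] using (measurable_pi_apply i).comp measurable_snd

theorem measurable_eLpNorm_cons {n : ℕ} {p : ℝ≥0∞} (hp : 1 < p ∧ p < ∞)
    {f : (Fin (n + 1) → ℝ) → ℝ≥0∞} (hf : Measurable f) :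
    Measurable fun y : Fin n → ℝ => eLpNorm (fun t : ℝ => f (Fin.cons t y)) p volume := by
  simp_rw [eLpNorm_eq_lintegral_rpow volume hp]
  exact (Measurable.lintegral_prod_left'
    (f := fun z : ℝ × (Fin n → ℝ) => f (Fin.cons z.1 z.2) ^ p.toReal)
    ((hf.comp (measurable_cons n)).pow_const _)).pow_const _

theorem mixedNorm_mono {n : ℕ} (p : Fin n → ℝ≥0∞) {f g : (Fin n → ℝ) → ℝ≥0∞}
    (h : ∀ x, f x ≤ g x) : mixedNorm p f ≤ mixedNorm p g := by
  induction n with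
  | zero => exact h _
  | succ n ih => exact ih _ fun y => eLpNorm_mono_enorm fun t => h _

theorem mixedNorm_const_mul {n : ℕ} {p : Fin n → ℝ≥0∞} (hp : ∀ i, 1 < p i ∧ p i < ∞) (c : ℝ≥0∞)
    {f : (Fin n → ℝ) → ℝ≥0∞} (hf : Measurable f) :
    mixedNorm p (fun x => c * f x) = c * mixedNorm p f := by
  induction n with
  | zero => rfl
  | succ n ih =>
    have h0 := one_lt_toReal (hp 0)
    have h0' : 0 < (p 0).toReal := by linarith
    rw [mixedNorm, mixedNorm, ← ih (p := Fin.tail p) (fun i => hp i.succ)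
      (measurable_eLpNorm_cons (hp 0) hf)]
    congr 1
    funext y
    have hm : Measurable fun t : ℝ => f (Fin.cons t y) :=
      hf.comp ((measurable_cons n).comp (measurable_id.prodMk measurable_const))
    simp_rw [eLpNorm_eq_lintegral_rpow volume (hp 0), ENNReal.mul_rpow_of_nonneg _ _ h0'.le]
    rw [lintegral_const_mul _ (hm.pow_const _), ENNReal.mul_rpow_of_nonneg _ _ (by positivity),
      ← ENNReal.rpow_mul, mul_one_div_cancel h0'.ne', ENNReal.rpow_one]

theorem mixedNorm_add_le {n : ℕ} {p : Fin n → ℝ≥0∞} (hp : ∀ i, 1 < p i ∧ p i < ∞)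
    {f g : (Fin n → ℝ) → ℝ≥0∞} (hf : Measurable f) (hg : Measurable g) :
    mixedNorm p (fun x => f x + g x) ≤ mixedNorm p f + mixedNorm p g := by
  induction n with
  | zero => exact le_rfl
  | succ n ih =>
    refine le_trans (mixedNorm_mono (Fin.tail p) fun y => ?_) (ih (p := Fin.tail p) (fun i => hp i.succ)
      (measurable_eLpNorm_cons (hp 0) hf) (measurable_eLpNorm_cons (hp 0) hg))
    have hc := (measurable_cons n).comp (measurable_id.prodMk (measurable_const (a := y)))
    exact eLpNorm_add_le (hf.comp hc).aestronglyMeasurable (hg.comp hc).aestronglyMeasurable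
      (hp 0).1.le

theorem mem_cube_cons {n : ℕ} {R t : ℝ} {y : Fin n → ℝ} :
    (Fin.cons t y : Fin (n + 1) → ℝ) ∈ cube 0 R ↔ t ∈ Ioo (-R) R ∧ y ∈ cube 0 R := by
  simp [cube, Fin.forall_fin_succ, abs_lt]

/-- The exponent `∑ 1 / p_i` is the scaling exponent against which `lam` is compared. -/
theorem mixedNormOn_cube_const {n : ℕ} {p : Fin n → ℝ≥0∞} (hp : ∀ i, 1 < p i ∧ p i < ∞) {R : ℝ}
    (hR : 0 < R) (c : ℝ≥0∞) :
    mixedNormOn p (cube 0 R) (fun _ => c) = c * ENNReal.ofReal (2 * R) ^ ∑ i, 1 / (p i).toReal := by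
  unfold mixedNormOn
  induction n generalizing c with
  | zero =>
    have : (Fin.elim0 : Fin 0 → ℝ) ∈ cube 0 R := fun i => i.elim0
    simp only [mixedNorm, indicator_of_mem this, Finset.univ_eq_empty, Finset.sum_empty,
      ENNReal.rpow_zero, mul_one]
  | succ n ih =>
    have hR2 : ENNReal.ofReal (2 * R) ≠ 0 := by simpa using hR
    have key : (fun y : Fin n → ℝ => eLpNorm (fun t : ℝ => (cube 0 R).indicator
        (fun _ : Fin (n + 1) → ℝ => c) (Fin.cons t y)) (p 0) volume) =
        (cube 0 R).indicator fun _ => c * ENNReal.ofReal (2 * R) ^ (1 / (p 0).toReal) := by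
      funext y
      by_cases hy : y ∈ cube 0 R
      · have : (fun t : ℝ => (cube 0 R).indicator
            (fun _ : Fin (n + 1) → ℝ => c) (Fin.cons t y)) = (Ioo (-R) R).indicator fun _ => c := by
          funext t
          by_cases ht : t ∈ Ioo (-R) R
          · rw [indicator_of_mem ht, indicator_of_mem (mem_cube_cons.2 ⟨ht, hy⟩)]
          · rw [indicator_of_notMem ht, indicator_of_notMem fun h => ht (mem_cube_cons.1 h).1]
        rw [this, eLpNorm_indicator_const measurableSet_Ioo (zero_lt_one.trans (hp 0).1).ne'
          (hp 0).2.ne, indicator_of_mem hy, Real.volume_Ioo, enorm_eq_self]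
        congr 3
        ring
      · have : (fun t : ℝ => (cube 0 R).indicator
            (fun _ : Fin (n + 1) → ℝ => c) (Fin.cons t y)) = 0 := by
          funext t
          simp [mem_cube_cons, hy]
        rw [this, indicator_of_notMem hy, eLpNorm_zero]
    rw [mixedNorm, key, ih (p := Fin.tail p) (fun i => hp i.succ), Fin.sum_univ_succ,
      ENNReal.rpow_add _ _ hR2 ENNReal.ofReal_ne_top, mul_assoc]
    rfl

/-- One-dimensional weighted bounds in one coordinate imply bounds in mixed norms. -/
theorem exists_mixedNorm_le_of_weightedBound {n : ℕ} {p : Fin n → ℝ≥0∞}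
    (hp : ∀ i, 1 < p i ∧ p i < ∞) (i : Fin n) (B : ℝ → ℝ≥0 → ℝ≥0) :
    ∃ C : ℝ≥0, ∀ F G : (Fin n → ℝ) → ℝ≥0∞, Measurable F → Measurable G →
      (∀ x, WeightedBound B (fun t => F (Function.update x i t))
        (fun t => G (Function.update x i t))) →
      mixedNorm p F ≤ C * mixedNorm p G := by
  induction n generalizing B with
  | zero => exact i.elim0
  | succ n ih =>
    have h0 := one_lt_toReal (hp 0)
    have h0' : 0 < (p 0).toReal := by linarith
    refine Fin.cases ?_ (fun i => ?_) i
    -- In the innermost variable the unweighted bound suffices; the outer norms are monotone.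
    · refine ⟨B (p 0).toReal 1 ^ (1 / (p 0).toReal), fun F G hF hG h => ?_⟩
      rw [mixedNorm, mixedNorm, ← mixedNorm_const_mul (p := Fin.tail p) (fun i => hp i.succ) _
        (measurable_eLpNorm_cons (hp 0) hG)]
      refine mixedNorm_mono _ fun y => ?_
      have hy := (h (Fin.cons 0 y)).lintegral_rpow_le h0
      simp only [Fin.update_cons_zero] at hy
      rw [eLpNorm_eq_lintegral_rpow volume (hp 0), eLpNorm_eq_lintegral_rpow volume (hp 0),
        ENNReal.coe_rpow_of_nonneg _ (by positivity), ← ENNReal.mul_rpow_of_nonneg _ _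
        (by positivity)]
      exact ENNReal.rpow_le_rpow hy (by positivity)
    -- For a later variable, the innermost norm is an `L^{p 0}` norm over a parameter. It preserves
    -- weighted bounds with new constants `B'`, hence the induction over all `B`.
    · obtain ⟨B', hB'⟩ := exists_weightedBound_lintegral h0 B
      obtain ⟨C, hC⟩ := ih (p := Fin.tail p) (fun i => hp i.succ) i B'
      refine ⟨C, fun F G hF hG h => hC _ _ (measurable_eLpNorm_cons (hp 0) hF)
        (measurable_eLpNorm_cons (hp 0) hG) fun y => ?_⟩
      simp_rw [eLpNorm_eq_lintegral_rpow volume (hp 0)]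
      have hm : Measurable fun z : ℝ × ℝ =>
          (Fin.cons z.1 (Function.update y i z.2) : Fin (n + 1) → ℝ) :=
        (measurable_cons n).comp (measurable_fst.prodMk
          ((measurable_update y).comp measurable_snd))
      refine hB' volume (fun s t => F (Fin.cons s (Function.update y i t)))
        (fun s t => G (Fin.cons s (Function.update y i t))) (hF.comp hm) (hG.comp hm) fun s => ?_
      have := h (Fin.cons s y)
      simpa only [Fin.cons_update] using this

/-! ### Iterated maximal functions and averages over cubes -/

/-- The one-dimensional maximal function in the `i`-th variable. -/
noncomputable def coordMaximal {n : ℕ} (i : Fin n) (f : (Fin n → ℝ) → ℝ≥0∞) (x : Fin n → ℝ) :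
    ℝ≥0∞ :=
  intervalMaximal volume (fun t => f (Function.update x i t)) (x i)

theorem coordMaximal_update {n : ℕ} (i : Fin n) (f : (Fin n → ℝ) → ℝ≥0∞) (x : Fin n → ℝ) (t : ℝ) :
    coordMaximal i f (Function.update x i t) =
      intervalMaximal volume (fun t => f (Function.update x i t)) t := by
  simp [coordMaximal]

theorem measurable_coordMaximal {n : ℕ} (i : Fin n) {f : (Fin n → ℝ) → ℝ≥0∞} (hf : Measurable f) :
    Measurable (coordMaximal i f) := by
  have : coordMaximal i f = fun x => ⨆ I : ℚ × ℚ,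
      {x : Fin n → ℝ | x i ∈ Ioo (I.1 : ℝ) I.2}.indicator
      (fun x => (volume (Ioo (I.1 : ℝ) I.2))⁻¹ *
        ∫⁻ t in Ioo (I.1 : ℝ) I.2, f (Function.update x i t)) x := by
    funext x
    unfold coordMaximal intervalMaximal
    congr! 2 with I
    by_cases hx : x i ∈ Ioo (I.1 : ℝ) I.2
    · rw [iSup_pos hx, indicator_of_mem (by exact hx)]
    · rw [iSup_neg hx, indicator_of_notMem (by exact hx), bot_eq_zero]
  rw [this]
  refine Measurable.iSup fun I => Measurable.indicator ?_ (measurable_pi_apply i measurableSet_Ioo)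
  refine Measurable.const_mul ?_ _
  exact Measurable.lintegral_prod_right'
    (f := fun z : (Fin n → ℝ) × ℝ => f (Function.update z.1 i z.2)) (hf.comp measurable_update')

theorem measurable_seqNorm {α : Type*} [MeasurableSpace α] (v : ℝ) {f : ℕ → α → ℝ≥0∞}
    (hf : ∀ j, Measurable (f j)) : Measurable fun x => seqNorm v fun j => f j x :=
  (Measurable.tsum fun j => (hf j).pow_const v).pow_const _

theorem measurable_uncurry_of_countable {f : ℕ → ℝ → ℝ≥0∞} (hf : ∀ j, Measurable (f j)) :
    Measurable (Function.uncurry f) :=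
  measurable_from_prod_countable_right hf

/-- The Fefferman–Stein inequality in mixed norms for the maximal function in one variable. -/
theorem exists_mixedNorm_coordMaximal_le {n : ℕ} {p : Fin n → ℝ≥0∞}
    (hp : ∀ i, 1 < p i ∧ p i < ∞) {v : ℝ} (hv : 1 < v) (i : Fin n) :
    ∃ C : ℝ≥0, ∀ f : ℕ → (Fin n → ℝ) → ℝ≥0∞, (∀ j, Measurable (f j)) →
      mixedNorm p (fun x => seqNorm v fun j => coordMaximal i (f j) x) ≤
        C * mixedNorm p (fun x => seqNorm v fun j => f j x) := by
  obtain ⟨B, hB⟩ := exists_weightedBound_intervalMaximal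
  obtain ⟨B', hB'⟩ := exists_weightedBound_lintegral hv B
  obtain ⟨C, hC⟩ := exists_mixedNorm_le_of_weightedBound hp i B'
  refine ⟨C, fun f hf => hC (fun x => seqNorm v fun j => coordMaximal i (f j) x)
    (fun x => seqNorm v fun j => f j x)
    (measurable_seqNorm v fun j => measurable_coordMaximal i (hf j))
    (measurable_seqNorm v hf) fun x => ?_⟩
  have hm : ∀ j, Measurable fun t => f j (Function.update x i t) := fun j =>
    (hf j).comp (measurable_update x)
  have hm1 : Measurable (Function.uncurry fun (j : ℕ) =>
      intervalMaximal volume fun t => f j (Function.update x i t)) :=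
    measurable_uncurry_of_countable fun j => measurable_intervalMaximal volume _
  have hm2 : Measurable (Function.uncurry fun (j : ℕ) t => f j (Function.update x i t)) :=
    measurable_uncurry_of_countable hm
  -- The `ℓ^v` norm is the `L^v` norm for counting measure on `ℕ`.
  have h := hB' (Measure.count : Measure ℕ) _ _ hm1 hm2 fun j => hB _ (hm j)
  simp only [lintegral_count] at h
  simp only [seqNorm, coordMaximal_update]
  exact h

/-- The composition of the maximal functions in the variables of a list. -/
noncomputable def iterMaximal {n : ℕ} (l : List (Fin n)) (f : (Fin n → ℝ) → ℝ≥0∞) :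
    (Fin n → ℝ) → ℝ≥0∞ :=
  l.foldr coordMaximal f

theorem measurable_iterMaximal {n : ℕ} (l : List (Fin n)) {f : (Fin n → ℝ) → ℝ≥0∞}
    (hf : Measurable f) : Measurable (iterMaximal l f) := by
  induction l with
  | nil => exact hf
  | cons i l ih => exact measurable_coordMaximal i ih

theorem exists_mixedNorm_iterMaximal_le {n : ℕ} {p : Fin n → ℝ≥0∞}
    (hp : ∀ i, 1 < p i ∧ p i < ∞) {v : ℝ} (hv : 1 < v) (l : List (Fin n)) :
    ∃ C : ℝ≥0, ∀ f : ℕ → (Fin n → ℝ) → ℝ≥0∞, (∀ j, Measurable (f j)) →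
      mixedNorm p (fun x => seqNorm v fun j => iterMaximal l (f j) x) ≤
        C * mixedNorm p (fun x => seqNorm v fun j => f j x) := by
  induction l with
  | nil => exact ⟨1, fun f _ => by simp [iterMaximal]⟩
  | cons i l ih =>
    obtain ⟨C, hC⟩ := ih
    obtain ⟨D, hD⟩ := exists_mixedNorm_coordMaximal_le hp hv i
    refine ⟨D * C, fun f hf => (hD _ fun j => measurable_iterMaximal l (hf j)).trans ?_⟩
    push_cast
    rw [mul_assoc]
    exact mul_le_mul_right (hC f hf) _

/-- Integrating one variable at a time costs the side length times a one-variable maximal function;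
the point with one coordinate moved inside the box still lies in the box, so the induction
continues. -/
theorem lmarginal_le_iterMaximal {n : ℕ} {f : (Fin n → ℝ) → ℝ≥0∞} (hf : Measurable f)
    (J : Fin n → ℚ × ℚ) (l : List (Fin n)) (hl : l.Nodup) (x : Fin n → ℝ)
    (hx : ∀ i, x i ∈ Ioo ((J i).1 : ℝ) (J i).2) :
    lmarginal (fun i => volume.restrict (Ioo ((J i).1 : ℝ) (J i).2)) l.toFinset f x ≤
      (∏ i ∈ l.toFinset, volume (Ioo ((J i).1 : ℝ) (J i).2)) * iterMaximal l f x := by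
  induction l generalizing x with
  | nil => simp [iterMaximal]
  | cons i l ih =>
    rw [List.nodup_cons] at hl
    have hi : i ∉ l.toFinset := by simpa using hl.1
    have hI : (J i).1 < (J i).2 := by exact_mod_cast (hx i).1.trans (hx i).2
    rw [List.toFinset_cons, lmarginal_insert _ hf hi, Finset.prod_insert hi]
    calc _ ≤ ∫⁻ t in Ioo ((J i).1 : ℝ) (J i).2,
          (∏ i ∈ l.toFinset, volume (Ioo ((J i).1 : ℝ) (J i).2)) *
            iterMaximal l f (Function.update x i t) := by
          refine setLIntegral_mono' measurableSet_Ioo fun t ht => ih hl.2 _ fun k => ?_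
          by_cases hk : k = i
          · subst hk; simpa using ht
          · simpa [Function.update_of_ne hk] using hx k
      _ = (∏ i ∈ l.toFinset, volume (Ioo ((J i).1 : ℝ) (J i).2)) *
          ∫⁻ t in Ioo ((J i).1 : ℝ) (J i).2, iterMaximal l f (Function.update x i t) :=
          lintegral_const_mul _ ((measurable_iterMaximal l hf).comp (measurable_update x))
      _ ≤ (∏ i ∈ l.toFinset, volume (Ioo ((J i).1 : ℝ) (J i).2)) *
          (volume (Ioo ((J i).1 : ℝ) (J i).2) * iterMaximal (i :: l) f x) := by
          refine mul_le_mul_right ?_ _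
          have := le_intervalMaximal volume (fun t => iterMaximal l f (Function.update x i t))
            (J i) (hx i)
          rwa [mul_comm, ← div_eq_mul_inv, ENNReal.div_le_iff (volume_Ioo_ne_zero hI)
            volume_Ioo_ne_top, mul_comm] at this
      _ = _ := by ring

/-- The composition of the maximal functions in all variables. -/
noncomputable def strongMaximal {n : ℕ} (f : (Fin n → ℝ) → ℝ≥0∞) : (Fin n → ℝ) → ℝ≥0∞ :=
  iterMaximal (List.finRange n) f

theorem cube_eq_ball {n : ℕ} (c : Fin n → ℝ) {r : ℝ} (hr : 0 < r) : cube c r = Metric.ball c r := by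
  ext x
  simp [cube, Metric.mem_ball, dist_pi_lt_iff hr, Real.dist_eq]

theorem measurableSet_cube {n : ℕ} (c : Fin n → ℝ) (r : ℝ) : MeasurableSet (cube c r) := by
  unfold cube
  measurability

theorem volume_cube {n : ℕ} (c : Fin n → ℝ) {r : ℝ} (hr : 0 < r) :
    volume (cube c r) = ENNReal.ofReal (2 * r) ^ n := by
  rw [cube_eq_ball c hr, Real.volume_pi_ball c hr, Fintype.card_fin,
    ENNReal.ofReal_pow (by positivity)]

/-- The cube is enclosed in a box with rational endpoints and sides at most `4 * r`, twice the
original; this costs `2 ^ n`. -/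
theorem inv_volume_cube_mul_lintegral_le {n : ℕ} {f : (Fin n → ℝ) → ℝ≥0∞} (hf : Measurable f)
    {c x : Fin n → ℝ} {r : ℝ} (hr : 0 < r) (hx : x ∈ cube c r) :
    (volume (cube c r))⁻¹ * ∫⁻ y in cube c r, f y ≤ 2 ^ n * strongMaximal f x := by
  have ha : ∀ i, ∃ a : ℚ, c i - 2 * r < a ∧ (a : ℝ) < c i - r := fun i =>
    exists_rat_btwn (by linarith)
  have hb : ∀ i, ∃ b : ℚ, c i + r < b ∧ (b : ℝ) < c i + 2 * r := fun i =>
    exists_rat_btwn (by linarith)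
  choose a ha1 ha2 using ha
  choose b hb1 hb2 using hb
  have hsub : cube c r ⊆ univ.pi fun i => Ioo (a i : ℝ) (b i) := by
    intro y hy i _
    have := abs_lt.1 (hy i)
    exact ⟨by linarith [ha2 i], by linarith [hb1 i]⟩
  have h1 : ∫⁻ y in cube c r, f y ≤ ENNReal.ofReal (4 * r) ^ n * strongMaximal f x := by
    calc ∫⁻ y in cube c r, f y ≤ ∫⁻ y in univ.pi fun i => Ioo (a i : ℝ) (b i), f y :=
          lintegral_mono_set hsub
      _ = lmarginal (fun i => volume.restrict (Ioo ((a i, b i).1 : ℝ) (a i, b i).2))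
          (List.finRange n).toFinset f x := by
          rw [List.toFinset_finRange, lmarginal_univ, volume_pi, Measure.restrict_pi_pi]
      _ ≤ _ := lmarginal_le_iterMaximal hf (fun i => (a i, b i)) _ (List.nodup_finRange n) x
          fun i => hsub hx i (mem_univ i)
      _ ≤ _ := by
          refine mul_le_mul_left ?_ _
          rw [List.toFinset_finRange]
          refine (Finset.prod_le_pow_card _ _ (ENNReal.ofReal (4 * r)) fun i _ => ?_).trans_eq
            (by simp)
          rw [Real.volume_Ioo]
          exact ENNReal.ofReal_le_ofReal (by linarith [ha1 i, hb2 i])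
  have hne : ENNReal.ofReal (2 * r) ≠ 0 := by simpa using hr
  calc _ ≤ (ENNReal.ofReal (2 * r) ^ n)⁻¹ * (ENNReal.ofReal (4 * r) ^ n * strongMaximal f x) := by
        rw [volume_cube c hr]
        exact mul_le_mul_right h1 _
    _ = _ := by
        have : ENNReal.ofReal (4 * r) = 2 * ENNReal.ofReal (2 * r) := by
          rw [← ENNReal.ofReal_ofNat 2, ← ENNReal.ofReal_mul (by positivity)]
          congr 1
          ring
        rw [this, mul_pow, ← mul_assoc, mul_left_comm, ENNReal.inv_mul_cancel (pow_ne_zero _ hne)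
          (ENNReal.pow_ne_top ENNReal.ofReal_ne_top), mul_one]

/-- Equality almost everywhere leaves cube averages unchanged, and the inequality everywhere allows
a return to `|f|` by mere monotonicity of the norms. The function is set to zero on a measurable
null set. -/
theorem exists_measurable_minorant {n : ℕ} {f : (Fin n → ℝ) → ℂ}
    (hf : AEStronglyMeasurable f volume) :
    ∃ g : (Fin n → ℝ) → ℝ≥0∞, Measurable g ∧ (∀ x, g x ≤ ‖f x‖ₑ) ∧
      g =ᵐ[volume] fun x => ‖f x‖ₑ := by
  have hm : AEMeasurable (fun x => ‖f x‖ₑ) volume := hf.enorm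
  let N := toMeasurable volume {x | ‖f x‖ₑ ≠ hm.mk _ x}
  have hN : volume N = 0 := by
    rw [measure_toMeasurable]; exact hm.ae_eq_mk
  have hout : ∀ x ∉ N, ‖f x‖ₑ = hm.mk _ x := by
    intro x hx
    by_contra h
    exact hx (subset_toMeasurable volume _ h)
  refine ⟨Nᶜ.indicator (hm.mk _), hm.measurable_mk.indicator
    (measurableSet_toMeasurable _ _).compl, fun x => ?_, ?_⟩
  · by_cases hx : x ∈ N
    · simp [hx]
    · rw [indicator_of_mem (by exact hx), hout x hx]
  · filter_upwards [measure_eq_zero_iff_ae_notMem.1 hN] with x hx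
    rw [indicator_of_mem (by exact hx), hout x hx]

/-! ### `ℓ^v` norms and the splitting into small and large cubes -/

theorem tsum_rpow_le_rpow_tsum {v : ℝ} (hv : 1 ≤ v) (s : ℕ → ℝ≥0∞) :
    ∑' k, s k ^ v ≤ (∑' k, s k) ^ v := by
  have h : ∀ a : ℝ≥0∞, a ^ v = a * a ^ (v - 1) := fun a => by
    nth_rewrite 2 [← ENNReal.rpow_one a]
    rw [← ENNReal.rpow_add_of_nonneg _ _ zero_le_one (by linarith), add_sub_cancel]
  rw [h, ← ENNReal.tsum_mul_right]
  refine ENNReal.tsum_le_tsum fun k => ?_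
  rw [h]
  exact mul_le_mul_right (ENNReal.rpow_le_rpow (ENNReal.le_tsum k) (by linarith)) _

theorem seqNorm_mono {v : ℝ} (hv : 0 < v) {a b : ℕ → ℝ≥0∞} (h : ∀ j, a j ≤ b j) :
    seqNorm v a ≤ seqNorm v b :=
  ENNReal.rpow_le_rpow (ENNReal.tsum_le_tsum fun j => ENNReal.rpow_le_rpow (h j) hv.le)
    (by positivity)

theorem seqNorm_rpow {v : ℝ} (hv : 0 < v) (a : ℕ → ℝ≥0∞) : seqNorm v a ^ v = ∑' j, a j ^ v := by
  rw [seqNorm, ← ENNReal.rpow_mul, one_div_mul_cancel hv.ne', ENNReal.rpow_one]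

theorem seqNorm_const_mul {v : ℝ} (hv : 0 < v) (c : ℝ≥0∞) (a : ℕ → ℝ≥0∞) :
    seqNorm v (fun j => c * a j) = c * seqNorm v a := by
  simp_rw [seqNorm, ENNReal.mul_rpow_of_nonneg _ _ hv.le]
  rw [ENNReal.tsum_mul_left, ENNReal.mul_rpow_of_nonneg _ _ (by positivity), ← ENNReal.rpow_mul,
    mul_one_div_cancel hv.ne', ENNReal.rpow_one]

theorem seqNorm_indicator {α : Type*} {v : ℝ} (hv : 0 < v) (E : Set α) (f : ℕ → α → ℝ≥0∞) :
    (fun x => seqNorm v fun j => E.indicator (f j) x) =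
      E.indicator fun x => seqNorm v fun j => f j x := by
  funext x
  by_cases hx : x ∈ E
  · simp [hx]
  · simp [hx, seqNorm, hv]

/-- The hypothesis is on `v`-th powers because each cube falls under a single alternative; then `ℓ^1
⊆ ℓ^v` and superadditivity of `t ^ v` replace Minkowski's inequality. -/
theorem seqNorm_le_add_tsum {v : ℝ} (hv : 1 ≤ v) {x a : ℕ → ℝ≥0∞} {b : ℕ → ℕ → ℝ≥0∞}
    (h : ∀ j, x j ^ v ≤ a j ^ v + ∑' k, b k j ^ v) :
    seqNorm v x ≤ seqNorm v a + ∑' k, seqNorm v (b k) := by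
  have hv0 : 0 < v := by linarith
  rw [← ENNReal.rpow_le_rpow_iff hv0, seqNorm_rpow hv0]
  calc ∑' j, x j ^ v ≤ ∑' j, (a j ^ v + ∑' k, b k j ^ v) := ENNReal.tsum_le_tsum h
    _ = seqNorm v a ^ v + ∑' k, seqNorm v (b k) ^ v := by
        rw [ENNReal.tsum_add, ENNReal.tsum_comm]
        simp_rw [seqNorm_rpow hv0]
    _ ≤ seqNorm v a ^ v + (∑' k, seqNorm v (b k)) ^ v := by
        gcongr
        exact tsum_rpow_le_rpow_tsum hv _
    _ ≤ _ := ENNReal.add_rpow_le_rpow_add _ _ hv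

/-- The average of `g` over the cube centred at the origin. -/
noncomputable def centredAverage {n : ℕ} (g : (Fin n → ℝ) → ℝ≥0∞) (R : ℝ) : ℝ≥0∞ :=
  (volume (cube (0 : Fin n → ℝ) R))⁻¹ * ∫⁻ y in cube 0 R, g y

theorem inv_volume_cube_le {n : ℕ} (c : Fin n → ℝ) {ρ R : ℝ} (hρ : 0 < ρ) (hR : 0 < R)
    (h : R ≤ 8 * ρ) :
    (volume (cube c ρ))⁻¹ ≤ 8 ^ n * (volume (cube (0 : Fin n → ℝ) R))⁻¹ := by
  rw [volume_cube c hρ, volume_cube 0 hR]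
  have h1 : ENNReal.ofReal (2 * R) ≤ 8 * ENNReal.ofReal (2 * ρ) := by
    rw [← ENNReal.ofReal_ofNat 8, ← ENNReal.ofReal_mul (by positivity)]
    exact ENNReal.ofReal_le_ofReal (by linarith)
  have h8 : (8 : ℝ≥0∞) ^ n * (8 ^ n)⁻¹ = 1 := ENNReal.mul_inv_cancel (by simp) (by simp)
  calc (ENNReal.ofReal (2 * ρ) ^ n)⁻¹
      = 8 ^ n * ((8 * ENNReal.ofReal (2 * ρ)) ^ n)⁻¹ := by
        rw [mul_pow, ENNReal.mul_inv (by simp) (by simp), ← mul_assoc, h8, one_mul]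
    _ ≤ _ := by gcongr

/-- Small cubes through `x` stay in `Q(0, 2r)`; large ones are swallowed by a comparable centred
cube, whose average does not depend on `x`. -/
theorem maximal_rpow_le {n : ℕ} {v : ℝ} (hv : 0 < v) {f : (Fin n → ℝ) → ℂ}
    {g : (Fin n → ℝ) → ℝ≥0∞} (hg : Measurable g) (hfg : g =ᵐ[volume] fun x => ‖f x‖ₑ) {r : ℝ}
    (hr : 0 < r) {x : Fin n → ℝ} (hx : x ∈ cube 0 r) :
    maximal f x ^ v ≤ (2 ^ n * strongMaximal ((cube 0 (2 * r)).indicator g) x) ^ v +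
      ∑' k : ℕ, (8 ^ n * centredAverage g (2 ^ k * r)) ^ v := by
  rw [← ENNReal.le_rpow_inv_iff hv]
  refine iSup_le fun c => iSup_le fun ρ => iSup₂_le fun hρ hxc => ?_
  rw [ENNReal.le_rpow_inv_iff hv]
  have hfg' : ∫⁻ y in cube c ρ, ‖f y‖ₑ = ∫⁻ y in cube c ρ, g y :=
    lintegral_congr_ae (ae_restrict_of_ae hfg.symm)
  have hsub : cube c ρ ⊆ cube 0 (r + 2 * ρ) := by
    intro y hy i
    have h1 := abs_lt.1 (hy i)
    have h2 := abs_lt.1 (hx i)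
    have h3 := abs_lt.1 (hxc i)
    simp only [Pi.zero_apply, sub_zero] at h2 ⊢
    rw [abs_lt]
    constructor <;> linarith
  rw [hfg']
  by_cases h : 2 * ρ ≤ r
  · refine le_add_right (ENNReal.rpow_le_rpow ?_ hv.le)
    have hind : ∫⁻ y in cube c ρ, g y = ∫⁻ y in cube c ρ, (cube 0 (2 * r)).indicator g y := by
      refine setLIntegral_congr_fun (measurableSet_cube c ρ) fun y hy => ?_
      rw [indicator_of_mem]
      intro i
      exact (hsub hy i).trans_le (by linarith)
    rw [hind]
    exact inv_volume_cube_mul_lintegral_le (hg.indicator (measurableSet_cube _ _)) hρ hxc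
  -- The centred cube has half-side `2 ^ (m + 1) * r ≤ 2 * (r + 2 * ρ)`, and this is below `8 * ρ`
  -- because `r < 2 * ρ`.
  · obtain ⟨m, hm1, hm2⟩ := exists_nat_pow_near (x := (r + 2 * ρ) / r) (y := 2)
      (by rw [one_le_div hr]; linarith) one_lt_two
    rw [le_div_iff₀ hr] at hm1
    rw [div_lt_iff₀ hr] at hm2
    refine le_add_left (le_trans (ENNReal.rpow_le_rpow ?_ hv.le) (ENNReal.le_tsum (m + 1)))
    rw [centredAverage, ← mul_assoc]
    refine mul_le_mul' (inv_volume_cube_le c hρ (by positivity) ?_) (lintegral_mono_set fun y hy i =>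
      (hsub hy i).trans hm2)
    rw [pow_succ]
    linarith

section Local

variable {n : ℕ} {p : Fin n → ℝ≥0∞} {v : ℝ} {C : ℝ≥0}

/-- On `Q(0, R)` the averages are constants lying below `2 ^ n` times the iterated maximal function
of `g j` cut off to that cube. Boundedness of that function thus does the work of Hölder's
inequality. -/
theorem seqNorm_centredAverage_mul_le (hp : ∀ i, 1 < p i ∧ p i < ∞) (hv : 1 < v)
    (hC : ∀ g : ℕ → (Fin n → ℝ) → ℝ≥0∞, (∀ j, Measurable (g j)) →
      mixedNorm p (fun x => seqNorm v fun j => strongMaximal (g j) x) ≤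
        C * mixedNorm p (fun x => seqNorm v fun j => g j x))
    {g : ℕ → (Fin n → ℝ) → ℝ≥0∞} (hg : ∀ j, Measurable (g j)) {R : ℝ} (hR : 0 < R) :
    seqNorm v (fun j => centredAverage (g j) R) * ENNReal.ofReal (2 * R) ^ ∑ i, 1 / (p i).toReal ≤
      2 ^ n * C * mixedNormOn p (cube 0 R) (fun x => seqNorm v fun j => g j x) := by
  have hv0 : 0 < v := by linarith
  have hgR : ∀ j, Measurable ((cube 0 R).indicator (g j)) := fun j =>
    (hg j).indicator (measurableSet_cube _ _)
  have hsm : Measurable fun x => seqNorm v fun j => strongMaximal ((cube 0 R).indicator (g j)) x :=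
    measurable_seqNorm v fun j => measurable_iterMaximal _ (hgR j)
  rw [← mixedNormOn_cube_const hp hR]
  calc mixedNormOn p (cube 0 R) (fun _ => seqNorm v fun j => centredAverage (g j) R)
      ≤ mixedNorm p (fun x => 2 ^ n *
          seqNorm v fun j => strongMaximal ((cube 0 R).indicator (g j)) x) := by
        refine mixedNorm_mono p fun x => ?_
        by_cases hx : x ∈ cube 0 R
        · rw [indicator_of_mem hx, ← seqNorm_const_mul hv0]
          refine seqNorm_mono hv0 fun j => ?_
          refine le_trans (le_of_eq ?_) (inv_volume_cube_mul_lintegral_le (hgR j) hR hx)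
          rw [centredAverage, setLIntegral_indicator (measurableSet_cube _ _), inter_self]
        · rw [indicator_of_notMem hx]
          exact bot_le
    _ ≤ 2 ^ n * (C * mixedNorm p fun x => seqNorm v fun j => (cube 0 R).indicator (g j) x) := by
        rw [mixedNorm_const_mul hp _ hsm]
        exact mul_le_mul_right (hC _ hgR) _
    _ = _ := by rw [seqNorm_indicator hv0, mul_assoc]; rfl

theorem mixedNormOn_cube_maximal_le (hp : ∀ i, 1 < p i ∧ p i < ∞) (hv : 1 < v)
    (hC : ∀ g : ℕ → (Fin n → ℝ) → ℝ≥0∞, (∀ j, Measurable (g j)) →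
      mixedNorm p (fun x => seqNorm v fun j => strongMaximal (g j) x) ≤
        C * mixedNorm p (fun x => seqNorm v fun j => g j x))
    {f : ℕ → (Fin n → ℝ) → ℂ} {g : ℕ → (Fin n → ℝ) → ℝ≥0∞} (hg : ∀ j, Measurable (g j))
    (hfg : ∀ j, g j =ᵐ[volume] fun x => ‖f j x‖ₑ) {r : ℝ} (hr : 0 < r) :
    mixedNormOn p (cube 0 r) (fun x => seqNorm v fun j => maximal (f j) x) ≤
      (2 ^ (∑ i, 1 / (p i).toReal) + 8 ^ n) * (2 ^ n * C) * ∑' k : ℕ,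
        ((2 : ℝ≥0∞) ^ (-∑ i, 1 / (p i).toReal)) ^ k *
          mixedNormOn p (cube 0 (2 ^ k * r)) (fun x => seqNorm v fun j => g j x) := by
  have hv0 : 0 < v := by linarith
  set S := ∑ i, 1 / (p i).toReal with hS
  set Φ := fun R => mixedNormOn p (cube 0 R) (fun x => seqNorm v fun j => g j x) with hΦ
  have hgR : ∀ j, Measurable ((cube 0 (2 * r)).indicator (g j)) := fun j =>
    (hg j).indicator (measurableSet_cube _ _)
  have hsm : Measurable fun x =>
      seqNorm v fun j => strongMaximal ((cube 0 (2 * r)).indicator (g j)) x :=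
    measurable_seqNorm v fun j => measurable_iterMaximal _ (hgR j)
  set s : ℕ → ℝ≥0∞ := fun k => seqNorm v fun j => centredAverage (g j) (2 ^ k * r) with hs
  have hsplit : mixedNormOn p (cube 0 r) (fun x => seqNorm v fun j => maximal (f j) x) ≤
      2 ^ n * C * Φ (2 * r) + (∑' k, 8 ^ n * s k) * ENNReal.ofReal (2 * r) ^ S := by
    -- Monotonicity needs no measurability, so `maximal` is replaced by a measurable majorant before
    -- the triangle inequality.
    calc _ ≤ mixedNorm p (fun x => 2 ^ n * (seqNorm v fun j =>
            strongMaximal ((cube 0 (2 * r)).indicator (g j)) x) +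
            (cube 0 r).indicator (fun _ => ∑' k, 8 ^ n * s k) x) := by
          refine mixedNorm_mono p fun x => ?_
          by_cases hx : x ∈ cube 0 r
          · rw [indicator_of_mem hx, indicator_of_mem hx, ← seqNorm_const_mul hv0]
            refine (seqNorm_le_add_tsum hv.le fun j =>
              maximal_rpow_le hv0 (hg j) (hfg j) hr hx).trans_eq ?_
            simp_rw [seqNorm_const_mul hv0, hs]
          · rw [indicator_of_notMem hx]
            exact bot_le
      _ ≤ mixedNorm p (fun x => 2 ^ n * (seqNorm v fun j =>
            strongMaximal ((cube 0 (2 * r)).indicator (g j)) x)) +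
            mixedNormOn p (cube 0 r) (fun _ => ∑' k, 8 ^ n * s k) :=
          mixedNorm_add_le hp (hsm.const_mul _)
            (measurable_const.indicator (measurableSet_cube _ _))
      _ ≤ _ := by
          rw [mixedNormOn_cube_const hp hr, mixedNorm_const_mul hp _ hsm, mul_assoc]
          refine add_le_add_left (mul_le_mul_right ((hC _ hgR).trans_eq ?_) _) _
          rw [seqNorm_indicator hv0]
          rfl
  have h2 : (2 : ℝ≥0∞) ≠ 0 := two_ne_zero
  have h2t : (2 : ℝ≥0∞) ≠ ⊤ := ENNReal.ofNat_ne_top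
  have hterm : ∀ k, 8 ^ n * s k * ENNReal.ofReal (2 * r) ^ S ≤
      8 ^ n * (2 ^ n * C) * (((2 : ℝ≥0∞) ^ (-S)) ^ k * Φ (2 ^ k * r)) := by
    intro k
    -- Passing from `Q(0, r)` to `Q(0, 2^k r)` in the norm of a constant yields the decay `2 ^ (-k *
    -- S)`.
    have hk : ENNReal.ofReal (2 * r) ^ S =
        ((2 : ℝ≥0∞) ^ (-S)) ^ k * ENNReal.ofReal (2 * (2 ^ k * r)) ^ S := by
      have h4 : ENNReal.ofReal (2 * (2 ^ k * r)) = 2 ^ k * ENNReal.ofReal (2 * r) := by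
        rw [mul_left_comm, ENNReal.ofReal_mul (by positivity), ENNReal.ofReal_pow (by positivity),
          ENNReal.ofReal_ofNat]
      rw [h4, ENNReal.mul_rpow_of_ne_top (ENNReal.pow_ne_top h2t) ENNReal.ofReal_ne_top,
        ← ENNReal.rpow_natCast, ← ENNReal.rpow_natCast, ← ENNReal.rpow_mul, ← ENNReal.rpow_mul,
        ← mul_assoc, ← ENNReal.rpow_add _ _ h2 h2t,
        show -S * k + k * S = 0 by ring, ENNReal.rpow_zero, one_mul]
    have := seqNorm_centredAverage_mul_le hp hv hC hg (R := 2 ^ k * r) (by positivity)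
    calc _ = 8 ^ n * ((2 : ℝ≥0∞) ^ (-S)) ^ k *
          (s k * ENNReal.ofReal (2 * (2 ^ k * r)) ^ S) := by rw [hk]; ring
      _ ≤ 8 ^ n * ((2 : ℝ≥0∞) ^ (-S)) ^ k * (2 ^ n * C * Φ (2 ^ k * r)) :=
          mul_le_mul_right this _
      _ = _ := by ring
  -- The local part is the term `k = 1` of the same series; `2 ^ S` undoes its weight.
  have hfirst : Φ (2 * r) ≤ 2 ^ S * ∑' k : ℕ, ((2 : ℝ≥0∞) ^ (-S)) ^ k * Φ (2 ^ k * r) := by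
    calc Φ (2 * r) = 2 ^ S * (((2 : ℝ≥0∞) ^ (-S)) ^ 1 * Φ (2 ^ 1 * r)) := by
          rw [pow_one, pow_one, ← mul_assoc, ← ENNReal.rpow_add _ _ h2 h2t, add_neg_cancel,
            ENNReal.rpow_zero, one_mul]
      _ ≤ _ := mul_le_mul_right (ENNReal.le_tsum 1) _
  refine hsplit.trans ?_
  rw [← ENNReal.tsum_mul_right, add_mul, add_mul]
  refine add_le_add ?_ ?_
  · calc _ ≤ 2 ^ n * C * (2 ^ S * ∑' k : ℕ, ((2 : ℝ≥0∞) ^ (-S)) ^ k * Φ (2 ^ k * r)) :=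
          mul_le_mul_right hfirst _
      _ = _ := by ring
  · rw [← ENNReal.tsum_mul_left]
    exact ENNReal.tsum_le_tsum hterm

end Local

/-! ### Dilations and Hardy's inequality for `dr / r` -/

theorem measurePreserving_mul_haarHalfLine {c : ℝ} (hc : 0 < c) :
    MeasurePreserving (fun r => c * r) haarHalfLine haarHalfLine := by
  have hm : Measurable fun r : ℝ => c * r := measurable_const_mul c
  refine ⟨hm, Measure.ext fun s hs => ?_⟩
  have happ : ∀ t : Set ℝ, MeasurableSet t → haarHalfLine t =
      ∫⁻ r, (t ∩ Ioi 0).indicator (fun r => ENNReal.ofReal r⁻¹) r := by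
    intro t ht
    rw [haarHalfLine, withDensity_apply _ ht, Measure.restrict_restrict ht,
      lintegral_indicator (ht.inter measurableSet_Ioi)]
  have hmeas : Measurable ((s ∩ Ioi 0).indicator fun r : ℝ => ENNReal.ofReal c *
      ENNReal.ofReal r⁻¹) :=
    Measurable.indicator (by fun_prop) (hs.inter measurableSet_Ioi)
  rw [Measure.map_apply hm hs, happ _ (hm hs), happ _ hs]
  calc _ = ∫⁻ r, (s ∩ Ioi 0).indicator (fun r => ENNReal.ofReal c * ENNReal.ofReal r⁻¹) (c * r) := by
        refine lintegral_congr fun r => ?_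
        by_cases hr : r ∈ (fun r => c * r) ⁻¹' s ∩ Ioi 0
        · have hr' : c * r ∈ s ∩ Ioi 0 := ⟨hr.1, mul_pos hc hr.2⟩
          rw [indicator_of_mem hr, indicator_of_mem hr', ← ENNReal.ofReal_mul hc.le, mul_inv,
            mul_inv_cancel_left₀ hc.ne']
        · have hr' : c * r ∉ s ∩ Ioi 0 := fun h => hr ⟨h.1, pos_of_mul_pos_right h.2 hc.le⟩
          rw [indicator_of_notMem hr, indicator_of_notMem hr']
    _ = ENNReal.ofReal c⁻¹ * ∫⁻ r, (s ∩ Ioi 0).indicator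
          (fun r => ENNReal.ofReal c * ENNReal.ofReal r⁻¹) r := by
        rw [← lintegral_map hmeas hm, Real.map_volume_mul_left hc.ne', lintegral_smul_measure,
          abs_of_pos (inv_pos.2 hc), smul_eq_mul]
    _ = _ := by
        rw [← lintegral_const_mul _ hmeas]
        refine lintegral_congr fun r => ?_
        by_cases hr : r ∈ s ∩ Ioi 0
        · rw [indicator_of_mem hr, indicator_of_mem hr, ← mul_assoc,
            ← ENNReal.ofReal_mul (inv_pos.2 hc).le, inv_mul_cancel₀ hc.ne', ENNReal.ofReal_one,
            one_mul]
        · rw [indicator_of_notMem hr, indicator_of_notMem hr, mul_zero]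

theorem ae_haarHalfLine_pos : ∀ᵐ r ∂haarHalfLine, 0 < r :=
  (withDensity_absolutelyContinuous _ _).ae_le (ae_restrict_mem measurableSet_Ioi)

/-- A discrete Hardy inequality on the half-line, valid for all exponents `0 < q ≤ ∞`. -/
theorem exists_eLpNorm_tsum_dilation_le {q : ℝ≥0∞} (hq : 0 < q) {ρ : ℝ≥0∞} (hρ : ρ < 1) :
    ∃ C : ℝ≥0, ∀ H : ℝ → ℝ≥0∞, Measurable H →
      eLpNorm (fun r => ∑' k : ℕ, ρ ^ (2 * k) * H (2 ^ k * r)) q haarHalfLine ≤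
        C * eLpNorm H q haarHalfLine := by
  have hsub : ∀ {a : ℝ≥0∞}, a < 1 → (1 - a)⁻¹ ≠ ⊤ := fun h =>
    ENNReal.inv_ne_top.2 (tsub_pos_of_lt h).ne'
  have hinv : ∀ (H : ℝ → ℝ≥0∞), Measurable H → ∀ k : ℕ,
      eLpNorm (fun r => H (2 ^ k * r)) q haarHalfLine = eLpNorm H q haarHalfLine := fun H hH k =>
    eLpNorm_comp_measurePreserving hH.aestronglyMeasurable
      (measurePreserving_mul_haarHalfLine (c := 2 ^ k) (by positivity))
  by_cases hqt : q = ⊤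
  · subst hqt
    refine ⟨((1 - ρ ^ 2)⁻¹).toNNReal, fun H hH => ?_⟩
    have hρ2 : ρ ^ 2 < 1 := pow_lt_one₀ bot_le hρ two_ne_zero
    rw [ENNReal.coe_toNNReal (hsub hρ2), eLpNorm_exponent_top, eLpNorm_exponent_top]
    refine eLpNormEssSup_le_of_ae_enorm_bound ?_
    have hk : ∀ k : ℕ, ∀ᵐ r ∂haarHalfLine, H (2 ^ k * r) ≤ eLpNormEssSup H haarHalfLine := by
      intro k
      have := hinv H hH k
      rw [eLpNorm_exponent_top, eLpNorm_exponent_top] at this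
      rw [← this]
      exact enorm_ae_le_eLpNormEssSup (fun r => H (2 ^ k * r)) haarHalfLine
    filter_upwards [ae_all_iff.2 hk] with r hr
    rw [enorm_eq_self, ← ENNReal.tsum_geometric, ← ENNReal.tsum_mul_right]
    refine ENNReal.tsum_le_tsum fun k => ?_
    rw [pow_mul]
    exact mul_le_mul_right (hr k) _
  · have hq0 : 0 < q.toReal := ENNReal.toReal_pos hq.ne' hqt
    have hρq : ρ ^ q.toReal < 1 := ENNReal.rpow_lt_one hρ hq0
    -- The first factor comes from `tsum_rpow_le_of_geometric`; the second sums the integrals, all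
    -- equal by dilation invariance.
    set D : ℝ≥0∞ := (1 - ρ)⁻¹ ^ q.toReal * (1 - ρ ^ q.toReal)⁻¹ with hD
    have hDt : D ≠ ⊤ := ENNReal.mul_ne_top (ENNReal.rpow_ne_top_of_nonneg hq0.le (hsub hρ))
      (hsub hρq)
    have hDt' : D ^ (1 / q.toReal) ≠ ⊤ := ENNReal.rpow_ne_top_of_nonneg (by positivity) hDt
    refine ⟨(D ^ (1 / q.toReal)).toNNReal, fun H hH => ?_⟩
    have hHk : ∀ k : ℕ, Measurable fun r => H (2 ^ k * r) := fun k =>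
      hH.comp (measurable_const_mul _)
    have hint : ∀ k : ℕ, ∫⁻ r, H (2 ^ k * r) ^ q.toReal ∂haarHalfLine =
        ∫⁻ r, H r ^ q.toReal ∂haarHalfLine := fun k =>
      (measurePreserving_mul_haarHalfLine (c := 2 ^ k) (by positivity)).lintegral_comp
        (hH.pow_const _)
    rw [ENNReal.coe_toNNReal hDt', eLpNorm_eq_lintegral_rpow_enorm_toReal hq.ne' hqt,
      eLpNorm_eq_lintegral_rpow_enorm_toReal hq.ne' hqt,
      ← ENNReal.mul_rpow_of_nonneg _ _ (by positivity)]
    refine ENNReal.rpow_le_rpow ?_ (by positivity)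
    simp only [enorm_eq_self]
    calc ∫⁻ r, (∑' k : ℕ, ρ ^ (2 * k) * H (2 ^ k * r)) ^ q.toReal ∂haarHalfLine
        ≤ ∫⁻ r, (1 - ρ)⁻¹ ^ q.toReal * ∑' k : ℕ, (ρ ^ q.toReal) ^ k *
            H (2 ^ k * r) ^ q.toReal ∂haarHalfLine := by
          refine lintegral_mono fun r => (tsum_rpow_le_of_geometric hq0 _).trans_eq ?_
          congr 1
          refine tsum_congr fun k => ?_
          rw [ENNReal.mul_rpow_of_nonneg _ _ hq0.le, ← ENNReal.rpow_natCast,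
            ← ENNReal.rpow_natCast, ← ENNReal.rpow_mul, ← ENNReal.rpow_mul, mul_comm (k : ℝ)]
      _ = (1 - ρ)⁻¹ ^ q.toReal * ∑' k : ℕ, (ρ ^ q.toReal) ^ k *
            ∫⁻ r, H (2 ^ k * r) ^ q.toReal ∂haarHalfLine := by
          rw [lintegral_const_mul _ (Measurable.tsum fun k => ((hHk k).pow_const _).const_mul _),
            lintegral_tsum fun k => (((hHk k).pow_const _).const_mul _).aemeasurable]
          congr 1
          exact tsum_congr fun k => lintegral_const_mul _ ((hHk k).pow_const _)
      _ = D * ∫⁻ r, H r ^ q.toReal ∂haarHalfLine := by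
          simp_rw [hint]
          rw [ENNReal.tsum_mul_right, ENNReal.tsum_geometric, hD, mul_assoc]

end LocalMixedMorrey

/-! ### The local mixed Morrey estimate -/

open LocalMixedMorrey in
theorem theorem3p2 (n : ℕ) (p : Fin n → ℝ≥0∞) (hp : ∀ i, 1 < p i ∧ p i < ∞)
    (q : ℝ≥0∞) (hq : 0 < q) (v : ℝ) (hv : 1 < v)
    (lam : ℝ) (hlam : 0 ≤ lam) (hlam' : lam < ∑ i, 1 / (p i).toReal) :
    ∃ C : ℝ≥0, ∀ f : ℕ → (Fin n → ℝ) → ℂ, (∀ j, AEStronglyMeasurable (f j) volume) →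
      LocalMixedMorrey.localMorreyNorm p q lam
          (fun x => LocalMixedMorrey.seqNorm v fun j => LocalMixedMorrey.maximal (f j) x) ≤
        C * LocalMixedMorrey.localMorreyNorm p q lam
          (fun x => LocalMixedMorrey.seqNorm v fun j => ‖f j x‖ₑ) := by
  obtain ⟨C₀, hC₀⟩ := exists_mixedNorm_iterMaximal_le hp hv (List.finRange n)
  set S := ∑ i, 1 / (p i).toReal with hS
  -- The exponent is halved because the Hardy inequality uses `ρ ^ (2 * k)`; `ρ < 1` amounts to `lam
  -- < S`.
  set ρ : ℝ≥0∞ := 2 ^ (-((S - lam) / 2)) with hρdef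
  have h2 : (2 : ℝ≥0∞) ≠ 0 := two_ne_zero
  have h2t : (2 : ℝ≥0∞) ≠ ⊤ := ENNReal.ofNat_ne_top
  have hρ : ρ < 1 := ENNReal.rpow_lt_one_of_one_lt_of_neg ENNReal.one_lt_two (by linarith)
  obtain ⟨C₁, hC₁⟩ := exists_eLpNorm_tsum_dilation_le hq hρ
  set D : ℝ≥0 := (2 ^ S + 8 ^ n) * (2 ^ n * C₀) with hD
  have hDcoe : (D : ℝ≥0∞) = (2 ^ S + 8 ^ n) * (2 ^ n * C₀) := by
    rw [hD]
    push_cast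
    rw [ENNReal.coe_rpow_of_ne_zero two_ne_zero]
    rfl
  refine ⟨D * C₁, fun f hf => ?_⟩
  choose g hg hgle hfg using fun j => exists_measurable_minorant (hf j)
  set Φ := fun R => mixedNormOn p (cube 0 R) (fun x => seqNorm v fun j => g j x) with hΦ
  -- Monotonicity in the radius gives the measurability of `Φ` directly.
  have hΦmono : Monotone Φ := fun R R' h => mixedNorm_mono p fun x =>
    indicator_le_indicator_of_subset (fun y hy i => (hy i).trans_le h) (fun _ => bot_le) x
  set H : ℝ → ℝ≥0∞ := fun r => ENNReal.ofReal (r ^ (-lam)) * Φ r with hH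
  have hHm : Measurable H := by
    have := hΦmono.measurable
    fun_prop
  calc _ ≤ D • eLpNorm (fun r => ∑' k : ℕ, ρ ^ (2 * k) * H (2 ^ k * r)) q haarHalfLine := by
        refine eLpNorm_le_nnreal_smul_eLpNorm_of_ae_le_mul' ?_ q
        filter_upwards [ae_haarHalfLine_pos] with r hr
        rw [enorm_eq_self, enorm_eq_self]
        refine (mul_le_mul_right (mixedNormOn_cube_maximal_le hp hv hC₀ hg hfg hr) _).trans_eq ?_
        rw [mul_left_comm, ← hDcoe, ← ENNReal.tsum_mul_left]
        congr 1
        refine tsum_congr fun k => ?_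
        -- Moving `r ^ (-lam)` to the radius `2 ^ k * r` costs `2 ^ (k * lam)`, which combines with
        -- `2 ^ (-k * S)` to give `ρ ^ (2 * k)`.
        have e1 : ENNReal.ofReal (r ^ (-lam)) =
            2 ^ (k * lam) * ENNReal.ofReal ((2 ^ k * r) ^ (-lam)) := by
          rw [Real.mul_rpow (by positivity) hr.le, ENNReal.ofReal_mul (by positivity),
            ← Real.rpow_natCast, ← Real.rpow_mul (by positivity),
            ← ENNReal.ofReal_rpow_of_pos two_pos, ENNReal.ofReal_ofNat, ← mul_assoc,
            ← ENNReal.rpow_add _ _ h2 h2t, show (k : ℝ) * lam + k * -lam = 0 by ring,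
            ENNReal.rpow_zero, one_mul]
        have e2 : ρ ^ (2 * k) = (2 : ℝ≥0∞) ^ (k * lam) * ((2 : ℝ≥0∞) ^ (-S)) ^ k := by
          rw [hρdef, ← ENNReal.rpow_natCast, ← ENNReal.rpow_natCast, ← ENNReal.rpow_mul,
            ← ENNReal.rpow_mul, ← ENNReal.rpow_add _ _ h2 h2t]
          congr 1
          push_cast
          ring
        rw [e1, e2]
        simp only [hH, hΦ]
        ring
    _ ≤ D * (C₁ * eLpNorm H q haarHalfLine) := by
        rw [ENNReal.smul_def, smul_eq_mul]
        exact mul_le_mul_right (hC₁ H hHm) _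
    _ ≤ _ := by
        push_cast
        rw [mul_assoc]
        refine mul_le_mul_right (mul_le_mul_right (eLpNorm_mono_enorm fun r => ?_) _) _
        rw [enorm_eq_self, enorm_eq_self]
        refine mul_le_mul_right (mixedNorm_mono p fun x => indicator_le_indicator ?_) _
        exact seqNorm_mono (by linarith) fun j => hgle j x
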